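/- Let $p\ge 0$ be an integer and let $\mathbb{C}_{4p}$ be the complex Clifford algebra generated by $e_1,\dots,e_{4p}$ with $e_\alpha e_\beta+e_\beta e_\alpha=-2\delta_{\alpha\beta}$. For $j=1,\dots,2p$ put $$\mathfrak{f}_j=-\tfrac12(e_{2j-1}-i\,e_{2j}),\qquad \mathfrak{f}_j^\dagger=\tfrac12(e_{2j-1}+i\,e_{2j}),$$ let $I=\prod_{j=1}^{2p}\mathfrak{f}_j\mathfrak{f}_j^\dagger$, let $\mathbb{S}=\mathbb{C}_{4p}I$ be the spinor space, and let $\mathbb{S}^r\subset\mathbb{S}$ be the complex linear span of all elements $\mathfrak{f}^\dagger_{j_1}\cdots\mathfrak{f}^\dagger_{j_r}I$. Consider on $\mathbb{S}$ the left multiplication operators $$P=\sum_{k=1}^p\mathfrak{f}_{2k}\mathfrak{f}_{2k-1},\qquad Q=\sum_{k=1}^p\mathfrak{f}^\dagger_{2k-1}\mathfrak{f}^\dagger_{2k},$$ and put, for $0\le s\le p$ and $0\le k\le p-s$, $$\mathbb{S}^s_s=\mathbb{S}^s\cap\operatorname{Ker}P,\qquad \mathbb{S}^{s+2k}_s=Q^k\,\mathbb{S}^s_s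 .$$ Let $J=\operatorname{diag}\begin{pmatrix}0&1\\-1&0\end{pmatrix}$ ($p$ diagonal blocks) and let $\mathfrak{sp}_{2p}(\mathbb{C})=\{A\in M_{2p}(\mathbb{C}) : A^TJ+JA=0\}$ act on $\mathbb{S}$ by letting $A=(a_{jk})$ act as left multiplication by $\sum_{j,k}a_{jk}\,\mathfrak{f}_j^\dagger\mathfrak{f}_k$. Weights are given by their values on the basis $H_k=E_{2k-1,2k-1}-E_{2k,2k}$, $k=1,\dots,p$, of the diagonal Cartan subalgebra (so that $H_k$ acts as $\mathfrak{f}_{2k}\mathfrak{f}_{2k}^\dagger-\mathfrak{f}_{2k-1}\mathfrak{f}_{2k-1}^\dagger$), and the positive roots are $\varepsilon_j-\varepsilon_k$ for $j<k$ and $\varepsilon_j+\varepsilon_k$ for $j\le k$, where $\varepsilon_j(H_k)=\delta_{jk}$. Then, for every $r=0,\dots,p$: 1. $\mathbb{S}^r_r$ is an $\mathfrak{sp}_{2p}(\mathbb{C})$-submodule of $\mathbb{S}$, and it is irreducible with highest weight $(\underbrace{1,\dots,1}_{r},\underbrace{0,\dots,0}_{p-r})$. 2. $\mathbb{S}^r=\mathbb{S}^r_r\oplus\mathbb{S}^r_{r-2}\oplus\cdots\oplus\mathbb{S}^r_{r-2\lfloor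 r/2\rfloor}$, where $\mathbb{S}^r_{r-2j}=Q^j\,\mathbb{S}^{r-2j}_{r-2j}$, and each summand $\mathbb{S}^r_{r-2j}$, $0\le j\le\lfloor r/2\rfloor$, is an irreducible $\mathfrak{sp}_{2p}(\mathbb{C})$-submodule of $\mathbb{S}$. -/

import Mathlib

attribute [local instance 100] LieRing.ofAssociativeRing

noncomputable section

namespace SymplecticCells

/-! ### The complex Clifford algebra and the Witt basis -/

/-- The quadratic form `x ↦ -(x₁² + ⋯ + x₄ₚ²)` on `ℂ^{4p}`. -/
abbrev cliffordForm (p : ℕ) : QuadraticForm ℂ (Fin (4 * p) → ℂ) :=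
  QuadraticMap.weightedSumSquares ℂ (fun _ : Fin (4 * p) => (-1 : ℂ))

/-- The complex Clifford algebra `ℂ_{4p}`, with generators satisfying
`e_α e_β + e_β e_α = -2 δ_{αβ}`. -/
abbrev Cl (p : ℕ) : Type := CliffordAlgebra (cliffordForm p)

/-- The orthonormal generators `e_α` (numbered from `0`). -/
def gen (p : ℕ) (α : Fin (4 * p)) : Cl p :=
  CliffordAlgebra.ι (cliffordForm p) (Pi.single α 1)

/-- The generator `e_{2j-1}` attached to the `j`-th Witt pair (`j` is numbered from `0` here). -/
def eRe (p : ℕ) (j : Fin (2 * p)) : Cl p := gen p ⟨2 * j.val, by omega⟩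

/-- The generator `e_{2j}` attached to the `j`-th Witt pair (`j` is numbered from `0` here). -/
def eIm (p : ℕ) (j : Fin (2 * p)) : Cl p := gen p ⟨2 * j.val + 1, by omega⟩

/-- The Witt basis vector `𝔣_j = -½ (e_{2j-1} - i e_{2j})`. -/
def witt (p : ℕ) (j : Fin (2 * p)) : Cl p :=
  (-(1 / 2) : ℂ) • (eRe p j - Complex.I • eIm p j)

/-- The Witt basis vector `𝔣_j† = ½ (e_{2j-1} + i e_{2j})`. -/
def wittDag (p : ℕ) (j : Fin (2 * p)) : Cl p :=
  (1 / 2 : ℂ) • (eRe p j + Complex.I • eIm p j)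

/-- The odd label `2k-1`, for `k = 1, …, p` (labels are numbered from `0` in Lean). -/
def oddIdx (p : ℕ) (k : Fin p) : Fin (2 * p) := ⟨2 * k.val, by omega⟩

/-- The even label `2k`, for `k = 1, …, p` (labels are numbered from `0` in Lean). -/
def evenIdx (p : ℕ) (k : Fin p) : Fin (2 * p) := ⟨2 * k.val + 1, by omega⟩

/-! ### Spinor space and its homogeneous parts -/

/-- The primitive idempotent `I = I_1 I_2 ⋯ I_{2p}`, with `I_j = 𝔣_j 𝔣_j†`. -/
def idem (p : ℕ) : Cl p := (List.ofFn fun j : Fin (2 * p) => witt p j * wittDag p j).prod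

/-- Spinor space: the left ideal `𝕊 = ℂ_{4p} I`. -/
abbrev Spinor (p : ℕ) : Type := Submodule.span (Cl p) ({idem p} : Set (Cl p))

/-- The element `I` of spinor space. -/
def vac (p : ℕ) : Spinor p := ⟨idem p, Submodule.mem_span_singleton_self _⟩

/-- The homogeneous part `𝕊^r`, spanned by all `𝔣†_{s 1} ⋯ 𝔣†_{s r} I`. -/
def homSpinor (p r : ℕ) : Submodule ℂ (Spinor p) :=
  Submodule.span ℂ (Set.range fun s : Fin r → Fin (2 * p) =>
    (List.ofFn fun i => wittDag p (s i)).prod • vac p)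

/-- Left multiplication by `P = 𝔣_2 𝔣_1 + 𝔣_4 𝔣_3 + ⋯ + 𝔣_{2p} 𝔣_{2p-1}`. -/
def opP (p : ℕ) : Module.End ℂ (Spinor p) :=
  Algebra.lsmul ℂ ℂ (Spinor p) (∑ k : Fin p, witt p (evenIdx p k) * witt p (oddIdx p k))

/-- Left multiplication by `Q = 𝔣†_1 𝔣†_2 + 𝔣†_3 𝔣†_4 + ⋯ + 𝔣†_{2p-1} 𝔣†_{2p}`. -/
def opQ (p : ℕ) : Module.End ℂ (Spinor p) :=
  Algebra.lsmul ℂ ℂ (Spinor p) (∑ k : Fin p, wittDag p (oddIdx p k) * wittDag p (evenIdx p k))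

/-- The primitive part `𝕊^r_r = Ker P ∩ 𝕊^r`. -/
def primitivePart (p r : ℕ) : Submodule ℂ (Spinor p) := homSpinor p r ⊓ LinearMap.ker (opP p)

/-- The cell `𝕊^{s+2k}_s = Q^k 𝕊^s_s`. -/
def cell (p s k : ℕ) : Submodule ℂ (Spinor p) := (primitivePart p s).map (opQ p ^ k)

/-! ### The symplectic Lie algebra and its action on spinor space -/

/-- The matrix `𝕀_{2p} = diag (0 1; -1 0)` of the symplectic form. -/
def formMatrix (p : ℕ) : Matrix (Fin (2 * p)) (Fin (2 * p)) ℂ :=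
  ∑ k : Fin p, (Matrix.single (oddIdx p k) (evenIdx p k) 1 -
    Matrix.single (evenIdx p k) (oddIdx p k) 1)

/-- The Lie algebra `𝔰𝔭_{2p}(ℂ)` of all matrices `A` with `Aᵀ 𝕀_{2p} + 𝕀_{2p} A = 0`. -/
def sp (p : ℕ) : LieSubalgebra ℂ (Matrix (Fin (2 * p)) (Fin (2 * p)) ℂ) :=
  skewAdjointMatricesLieSubalgebra (formMatrix p)

theorem mem_sp_iff (p : ℕ) (A : Matrix (Fin (2 * p)) (Fin (2 * p)) ℂ) :
    A ∈ sp p ↔ A.transpose * formMatrix p + formMatrix p * A = 0 := by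
  rw [sp, mem_skewAdjointMatricesLieSubalgebra, mem_skewAdjointMatricesSubmodule]
  simp only [Matrix.IsSkewAdjoint, Matrix.IsAdjointPair, Matrix.mul_neg]
  exact eq_neg_iff_add_eq_zero

/-- The realization of matrices in the Clifford algebra: the matrix unit `E_{jk}` corresponds to
`𝔣_j† 𝔣_k`. On trace-free matrices, in particular on `𝔰𝔭_{2p}(ℂ)`, the values are bivectors. -/
def realize (p : ℕ) : Matrix (Fin (2 * p)) (Fin (2 * p)) ℂ →ₗ[ℂ] Cl p where
  toFun A := ∑ j, ∑ k, A j k • (wittDag p j * witt p k)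
  map_add' A B := by simp [add_smul, Finset.sum_add_distrib]
  map_smul' c A := by simp [Finset.smul_sum, mul_smul]

theorem gen_anticomm (p : ℕ) (α β : Fin (4 * p)) :
    gen p α * gen p β + gen p β * gen p α = algebraMap ℂ (Cl p) (if α = β then -2 else 0) := by
  rw [gen, gen, CliffordAlgebra.ι_mul_ι_add_swap]
  congr 1
  have h2 : QuadraticMap.polar (cliffordForm p) (Pi.single α 1) (Pi.single β 1) =
      ∑ i, (-2 : ℂ) * ((Pi.single α (1 : ℂ) : Fin (4 * p) → ℂ) i *
        (Pi.single β (1 : ℂ) : Fin (4 * p) → ℂ) i) := by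
    simp only [QuadraticMap.polar, cliffordForm, QuadraticMap.weightedSumSquares_apply,
      ← Finset.sum_sub_distrib, Pi.add_apply]
    refine Finset.sum_congr rfl fun i _ => ?_
    simp only [smul_eq_mul]
    ring
  rw [h2]
  by_cases h : α = β
  · subst h
    rw [Finset.sum_eq_single α] <;> simp +contextual
  · rw [if_neg h]
    refine Finset.sum_eq_zero fun i _ => ?_
    by_cases hi : i = α
    · subst hi; simp [h]
    · simp [hi]

theorem pair_anticomm (p : ℕ) (j k : Fin (2 * p)) (x y : ℂ) :
    (eRe p j + x • eIm p j) * (eRe p k + y • eIm p k) +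
      (eRe p k + y • eIm p k) * (eRe p j + x • eIm p j) =
    algebraMap ℂ (Cl p) (if j = k then -2 * (1 + x * y) else 0) := by
  have h1 : eRe p j * eRe p k + eRe p k * eRe p j =
      algebraMap ℂ (Cl p) (if j = k then -2 else 0) := by
    rw [eRe, eRe, gen_anticomm]; simp [Fin.ext_iff]
  have h2 : eRe p j * eIm p k + eIm p k * eRe p j = 0 := by
    rw [eRe, eIm, gen_anticomm, if_neg (by simp only [Fin.mk.injEq]; omega), map_zero]
  have h3 : eIm p j * eRe p k + eRe p k * eIm p j = 0 := by
    rw [eRe, eIm, gen_anticomm, if_neg (by simp only [Fin.mk.injEq]; omega), map_zero]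
  have h4 : eIm p j * eIm p k + eIm p k * eIm p j =
      algebraMap ℂ (Cl p) (if j = k then -2 else 0) := by
    rw [eIm, eIm, gen_anticomm]; simp [Fin.ext_iff]
  have h5 : (eRe p j + x • eIm p j) * (eRe p k + y • eIm p k) +
      (eRe p k + y • eIm p k) * (eRe p j + x • eIm p j) =
      (eRe p j * eRe p k + eRe p k * eRe p j) + y • (eRe p j * eIm p k + eIm p k * eRe p j) +
      x • (eIm p j * eRe p k + eRe p k * eIm p j) +
      (x * y) • (eIm p j * eIm p k + eIm p k * eIm p j) := by
    simp only [mul_add, add_mul, smul_mul_assoc, mul_smul_comm, smul_smul, smul_add, mul_comm y x]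
    abel
  rw [h5, h1, h2, h3, h4, smul_zero, smul_zero, add_zero, add_zero, Algebra.smul_def,
    ← map_mul, ← map_add]
  congr 1
  split_ifs <;> ring

theorem witt_eq (p : ℕ) (j : Fin (2 * p)) :
    witt p j = (-(1 / 2) : ℂ) • (eRe p j + (-Complex.I) • eIm p j) := by
  rw [witt, neg_smul Complex.I, sub_eq_add_neg]

theorem witt_mul_witt (p : ℕ) (j k : Fin (2 * p)) :
    witt p j * witt p k = -(witt p k * witt p j) := by
  rw [eq_neg_iff_add_eq_zero, witt_eq, witt_eq]
  simp only [smul_mul_assoc, mul_smul_comm, ← smul_add]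
  rw [pair_anticomm]
  simp

theorem wittDag_mul_wittDag (p : ℕ) (j k : Fin (2 * p)) :
    wittDag p j * wittDag p k = -(wittDag p k * wittDag p j) := by
  rw [eq_neg_iff_add_eq_zero, wittDag, wittDag]
  simp only [smul_mul_assoc, mul_smul_comm, ← smul_add]
  rw [pair_anticomm]
  simp

theorem witt_mul_wittDag (p : ℕ) (j k : Fin (2 * p)) :
    witt p j * wittDag p k =
      algebraMap ℂ (Cl p) (if j = k then 1 else 0) - wittDag p k * witt p j := by
  rw [eq_sub_iff_add_eq, witt_eq, wittDag]
  have h : ∀ X Y : Cl p, ((-(1 / 2) : ℂ) • X) * ((1 / 2 : ℂ) • Y) +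
      ((1 / 2 : ℂ) • Y) * ((-(1 / 2) : ℂ) • X) = (-(1 / 4) : ℂ) • (X * Y + Y * X) := by
    intro X Y
    simp only [smul_mul_assoc, mul_smul_comm, smul_smul, smul_add]
    norm_num
  rw [h, pair_anticomm, Algebra.smul_def, ← map_mul]
  congr 1
  split_ifs
  · simp; norm_num
  · simp

theorem unit_commutator (p : ℕ) (j k l m : Fin (2 * p)) :
    wittDag p j * witt p k * (wittDag p l * witt p m) -
      wittDag p l * witt p m * (wittDag p j * witt p k) =
    (if k = l then (1 : ℂ) else 0) • (wittDag p j * witt p m) -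
      (if m = j then (1 : ℂ) else 0) • (wittDag p l * witt p k) := by
  have h : ∀ a b c d : Fin (2 * p), wittDag p a * witt p b * (wittDag p c * witt p d) =
      (if b = c then (1 : ℂ) else 0) • (wittDag p a * witt p d) -
        wittDag p a * wittDag p c * (witt p b * witt p d) := by
    intro a b c d
    rw [show wittDag p a * witt p b * (wittDag p c * witt p d) =
      wittDag p a * (witt p b * wittDag p c) * witt p d by simp only [mul_assoc],
      witt_mul_wittDag, mul_sub, sub_mul, ← Algebra.commutes, ← Algebra.smul_def, smul_mul_assoc]
    simp only [mul_assoc]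
  rw [h, h, wittDag_mul_wittDag p l j, witt_mul_witt p m k, neg_mul_neg]
  abel

theorem realize_lie (p : ℕ) (A B : Matrix (Fin (2 * p)) (Fin (2 * p)) ℂ) :
    realize p ⁅A, B⁆ = realize p A * realize p B - realize p B * realize p A := by
  have hs : ∀ j k (x : ℂ), realize p (Matrix.single j k x) = x • (wittDag p j * witt p k) := by
    intro j k x
    simp only [realize, LinearMap.coe_mk, AddHom.coe_mk]
    rw [Finset.sum_eq_single j, Finset.sum_eq_single k] <;>
      simp +contextual [Matrix.single_apply, eq_comm]
  have hm : ∀ j k l m (x y : ℂ), realize p (Matrix.single j k x * Matrix.single l m y) =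
      (x * y) • ((if k = l then (1 : ℂ) else 0) • (wittDag p j * witt p m)) := by
    intro j k l m x y
    split_ifs with h
    · subst h; rw [Matrix.single_mul_single_same, hs, one_smul]
    · rw [Matrix.single_mul_single_of_ne _ _ _ _ h, map_zero, zero_smul, smul_zero]
  rw [Ring.lie_def, map_sub]
  induction A using Matrix.induction_on' with
  | h_zero => simp
  | h_add A A' hA hA' =>
    rw [add_mul, mul_add, map_add, map_add, map_add, add_mul, mul_add, add_sub_add_comm, hA, hA',
      add_sub_add_comm]
  | h_std_basis j k x =>
    induction B using Matrix.induction_on' with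
    | h_zero => simp
    | h_add B B' hB hB' =>
      rw [add_mul, mul_add, map_add, map_add, map_add, add_mul, mul_add, add_sub_add_comm, hB, hB',
        add_sub_add_comm]
    | h_std_basis l m y =>
      rw [hm, hm, hs, hs, mul_comm y x, ← smul_sub, ← unit_commutator]
      simp only [smul_mul_assoc, mul_smul_comm, smul_smul, smul_sub, mul_comm y x]

/-- `𝔰𝔭_{2p}(ℂ)` acts on spinor space by left multiplication, through its realization inside the
Clifford algebra. -/
instance instLieRingModuleSpinor (p : ℕ) : LieRingModule (sp p) (Spinor p) where
  bracket A ψ := realize p A.1 • ψ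
  add_lie A B ψ := by
    change realize p (A.1 + B.1) • ψ = _
    rw [map_add, add_smul]
  lie_add A ψ φ := smul_add _ ψ φ
  leibniz_lie A B ψ := by
    change realize p A.1 • realize p B.1 • ψ =
      realize p ⁅A.1, B.1⁆ • ψ + realize p B.1 • realize p A.1 • ψ
    rw [realize_lie, sub_smul, mul_smul, mul_smul, sub_add_cancel]

instance instLieModuleSpinor (p : ℕ) : LieModule ℂ (sp p) (Spinor p) where
  smul_lie c A ψ := by
    change realize p (c • A.1) • ψ = c • realize p A.1 • ψ
    rw [map_smul, smul_assoc]
  lie_smul c A ψ := smul_comm (realize p A.1) c ψ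

/-! ### Highest weights -/

theorem cartanMatrix_mem (p : ℕ) (k : Fin p) :
    Matrix.single (oddIdx p k) (oddIdx p k) 1 - Matrix.single (evenIdx p k) (evenIdx p k) 1 ∈
      sp p := by
  have h1 : ∀ i j : Fin p, oddIdx p i = oddIdx p j ↔ i = j := by
    intro i j; simp [oddIdx, Fin.ext_iff]
  have h2 : ∀ i j : Fin p, evenIdx p i = evenIdx p j ↔ i = j := by
    intro i j; simp [evenIdx, Fin.ext_iff]
  have h3 : ∀ i j : Fin p, oddIdx p i ≠ evenIdx p j := by
    intro i j; simp only [oddIdx, evenIdx, ne_eq, Fin.mk.injEq]; omega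
  rw [mem_sp_iff, formMatrix, Finset.mul_sum, Finset.sum_mul, ← Finset.sum_add_distrib]
  refine Finset.sum_eq_zero fun i _ => ?_
  by_cases hik : i = k
  · subst hik
    simp [Matrix.transpose_sub, sub_mul, mul_sub, h3, (h3 _ _).symm]
    abel
  · simp [Matrix.transpose_sub, sub_mul, mul_sub, h1, h2, h3, (h3 _ _).symm, hik, Ne.symm hik]

/-- The basis `H_k = E_{2k-1,2k-1} - E_{2k,2k}` of the diagonal Cartan subalgebra. In the Clifford
algebra it becomes `𝔣_{2k} 𝔣†_{2k} - 𝔣_{2k-1} 𝔣†_{2k-1}`. -/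
def cartanH (p : ℕ) (k : Fin p) : sp p := ⟨_, cartanMatrix_mem p k⟩

/-- The positive roots `ε_j - ε_k` (`j < k`) and `ε_j + ε_k` (`j ≤ k`), a linear functional on the
Cartan subalgebra being given by its values on `H_1, …, H_p`. -/
def positiveRoots (p : ℕ) : Set (Fin p → ℂ) :=
  {α | (∃ j k : Fin p, j < k ∧ α = Pi.single j 1 - Pi.single k 1) ∨
    (∃ j k : Fin p, j ≤ k ∧ α = Pi.single j 1 + Pi.single k 1)}

/-- `A` lies in the root space of `α`. -/
def IsRootVector (p : ℕ) (α : Fin p → ℂ) (A : sp p) : Prop :=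
  ∀ k : Fin p, ⁅cartanH p k, A⁆ = α k • A

/-- `M` is an irreducible `𝔰𝔭_{2p}(ℂ)`-module with highest weight `wt`: it is irreducible and has a
nonzero vector of weight `wt` that is annihilated by all positive root vectors. -/
def IsIrreducibleOfHighestWeight (p : ℕ) (wt : Fin p → ℂ) (M : Type*) [AddCommGroup M]
    [Module ℂ M] [LieRingModule (sp p) M] [LieModule ℂ (sp p) M] : Prop :=
  LieModule.IsIrreducible ℂ (sp p) M ∧
    ∃ v : M, v ≠ 0 ∧ (∀ k : Fin p, ⁅cartanH p k, v⁆ = wt k • v) ∧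
      ∀ α ∈ positiveRoots p, ∀ A : sp p, IsRootVector p α A → ⁅A, v⁆ = 0

/-- The weight `(1, …, 1, 0, …, 0)` with `r` ones. -/
def oneWeight (p r : ℕ) : Fin p → ℂ := fun k => if k.val < r then 1 else 0

end SymplecticCells

end

open SymplecticCells

namespace SymplecticCells

/-! ### Consequences of the canonical anticommutation relations -/

/-! The Witt elements satisfy the canonical anticommutation relations, so `𝕊` is a Fock space over
the vacuum `I`: the commuting idempotents `𝔣_j† 𝔣_j` and `𝔣_j 𝔣_j†` detect whether the label `j` is
occupied or vacant, and their number operator acts as `r` on `𝕊^r`. There `PQ - QP = p - r`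
(`opP_opQ`), an `𝔰𝔩₂` relation. Both `P` and `Q` commute with `𝔰𝔭_{2p}`, since the symplectic
condition makes `AJ` and `JA` symmetric whereas the Witt elements anticommute
(`realize_commute_clQ`, `realize_commute_clP`).

The decomposition is of Lefschetz type. On a primitive vector of degree `s`, the operator `P^m Q^m`
is a scalar, nonzero when `s + m ≤ p`. Subtracting multiples of `Q^m P^m x` from `x` peels off one
cell at a time (`mem_iSup_cell`). The cells of one degree lie in eigenspaces of `QP` for distinct
eigenvalues, so the sum is direct (`iSupIndep_cell`).

Irreducibility of `𝕊^r_r` rests on two facts. Every nonzero submodule contains a nonzero vector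
killed by all positive root vectors (`exists_annihilated_by_positiveRoots`), and such a vector is a
multiple of `topVec` (`exists_eq_smul_topVec`). In the second fact, the root vectors for `ε_j + ε_k`
together with `Px = 0` force all even labels to be vacant, those for `ε_j - ε_k` force the occupied
odd labels to form an initial segment, and the degree fixes its length. A bilinear form for which
`A` and `Aᵀ` are adjoint then replaces complete reducibility (`eq_primitiveLie_of_le`): a submodule
`N` and its orthogonal complement cannot both contain `topVec`, which is not isotropic, so the
complement of a nonzero `N` is zero and `N` has full dimension. Finally `Q^k` transports
irreducibility to the other cells. -/

theorem eq_zero_of_eq_neg_self {V : Type*} [AddCommGroup V] [Module ℂ V] {x : V} (h : x = -x) :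
    x = 0 := by
  have h2 : x = (1 / 2 : ℂ) • (x - -x) := by module
  rw [h2, ← h, sub_self, smul_zero]

theorem witt_mul_self (p : ℕ) (j : Fin (2 * p)) : witt p j * witt p j = 0 :=
  eq_zero_of_eq_neg_self (witt_mul_witt p j j)

theorem wittDag_mul_self (p : ℕ) (j : Fin (2 * p)) : wittDag p j * wittDag p j = 0 :=
  eq_zero_of_eq_neg_self (wittDag_mul_wittDag p j j)

theorem witt_mul_wittDag_self (p : ℕ) (j : Fin (2 * p)) :
    witt p j * wittDag p j = 1 - wittDag p j * witt p j := by
  simpa using witt_mul_wittDag p j j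

theorem witt_mul_wittDag_of_ne (p : ℕ) {j k : Fin (2 * p)} (h : j ≠ k) :
    witt p j * wittDag p k = -(wittDag p k * witt p j) := by
  simpa [h] using witt_mul_wittDag p j k

theorem wittDag_mul_witt_of_ne (p : ℕ) {j k : Fin (2 * p)} (h : j ≠ k) :
    wittDag p j * witt p k = -(witt p k * wittDag p j) := by
  rw [witt_mul_wittDag_of_ne p h.symm, neg_neg]

theorem witt_wittDag_witt (p : ℕ) (j : Fin (2 * p)) :
    witt p j * wittDag p j * witt p j = witt p j := by
  rw [witt_mul_wittDag_self, sub_mul, mul_assoc, witt_mul_self]; simp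

theorem wittDag_witt_wittDag (p : ℕ) (j : Fin (2 * p)) :
    wittDag p j * witt p j * wittDag p j = wittDag p j := by
  rw [mul_assoc, witt_mul_wittDag_self, mul_sub, ← mul_assoc, wittDag_mul_self]; simp

/-- The idempotent `𝔣_j 𝔣_j†`. -/
noncomputable def vacantProj (p : ℕ) (j : Fin (2 * p)) : Cl p := witt p j * wittDag p j

/-- The idempotent `𝔣_j† 𝔣_j`. -/
noncomputable def occProj (p : ℕ) (j : Fin (2 * p)) : Cl p := wittDag p j * witt p j

theorem vacantProj_add_occProj (p : ℕ) (j : Fin (2 * p)) :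
    vacantProj p j + occProj p j = 1 := by
  rw [vacantProj, occProj, witt_mul_wittDag_self, sub_add_cancel]

theorem vacantProj_mul_self (p : ℕ) (j : Fin (2 * p)) :
    vacantProj p j * vacantProj p j = vacantProj p j := by
  rw [vacantProj, ← mul_assoc, witt_wittDag_witt]

theorem occProj_mul_self (p : ℕ) (j : Fin (2 * p)) :
    occProj p j * occProj p j = occProj p j := by
  rw [occProj, ← mul_assoc, wittDag_witt_wittDag]

theorem commute_vacantProj_witt (p : ℕ) {j k : Fin (2 * p)} (h : j ≠ k) :
    Commute (vacantProj p j) (witt p k) := by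
  rw [Commute, SemiconjBy, vacantProj, mul_assoc, wittDag_mul_witt_of_ne p h, mul_neg,
    ← mul_assoc, witt_mul_witt p j k, neg_mul, neg_neg, mul_assoc]

theorem commute_vacantProj_wittDag (p : ℕ) {j k : Fin (2 * p)} (h : j ≠ k) :
    Commute (vacantProj p j) (wittDag p k) := by
  rw [Commute, SemiconjBy, vacantProj, mul_assoc, wittDag_mul_wittDag p j k, mul_neg,
    ← mul_assoc, witt_mul_wittDag_of_ne p h, neg_mul, neg_neg, mul_assoc]

theorem commute_vacantProj (p : ℕ) (j k : Fin (2 * p)) :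
    Commute (vacantProj p j) (vacantProj p k) := by
  rcases eq_or_ne j k with rfl | h
  · rfl
  · exact (commute_vacantProj_witt p h).mul_right (commute_vacantProj_wittDag p h)

theorem occProj_eq (p : ℕ) (j : Fin (2 * p)) : occProj p j = 1 - vacantProj p j :=
  eq_sub_of_add_eq' (vacantProj_add_occProj p j)

theorem commute_occProj (p : ℕ) (j k : Fin (2 * p)) :
    Commute (occProj p j) (occProj p k) := by
  rw [occProj_eq, occProj_eq]
  exact (Commute.one_left _).sub_left ((Commute.one_right _).sub_right (commute_vacantProj p j k))

/-! ### The vacuum -/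

theorem idem_eq (p : ℕ) :
    idem p = ((List.finRange (2 * p)).map (vacantProj p)).prod := by
  rw [idem, List.ofFn_eq_map]; rfl

/-- If `𝔣_j 𝔣_j† x = 0` and `x` commutes with `𝔣_j`, then `𝔣_j x = 𝔣_j 𝔣_j† 𝔣_j x = 𝔣_j 𝔣_j† x 𝔣_j =
0`. Both halves of `1 = 𝔣_j 𝔣_j† + 𝔣_j† 𝔣_j` then kill `x`, so factors can be stripped until only `1
≠ 0` is left. -/
theorem prod_vacantProj_ne_zero (p : ℕ) (l : List (Fin (2 * p))) (hl : l.Nodup) :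
    (l.map (vacantProj p)).prod ≠ 0 := by
  induction l with
  | nil => simp
  | cons j l ih =>
    rw [List.nodup_cons] at hl
    set x := (l.map (vacantProj p)).prod with hx
    have hc : Commute x (witt p j) := by
      refine Commute.list_prod_left _ _ fun y hy => ?_
      obtain ⟨k, hk, rfl⟩ := List.mem_map.mp hy
      exact commute_vacantProj_witt p (fun h => hl.1 (h ▸ hk))
    rw [List.map_cons, List.prod_cons, ← hx]
    intro h0
    have h1 : witt p j * x = 0 := by
      rw [← witt_wittDag_witt, mul_assoc, ← hc.eq, ← mul_assoc]
      rw [vacantProj] at h0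
      rw [h0, zero_mul]
    apply ih hl.2
    rw [← one_mul x, ← vacantProj_add_occProj p j, add_mul, h0, occProj, mul_assoc, h1]
    simp

theorem idem_ne_zero (p : ℕ) : idem p ≠ 0 := by
  rw [idem_eq]
  exact prod_vacantProj_ne_zero p _ (List.nodup_finRange _)

theorem vac_ne_zero (p : ℕ) : vac p ≠ 0 := fun h => idem_ne_zero p (congrArg Subtype.val h)

theorem mul_prod_vacantProj (p : ℕ) (j : Fin (2 * p)) (l : List (Fin (2 * p))) (hj : j ∈ l) :
    witt p j * (l.map (vacantProj p)).prod = 0 := by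
  induction l with
  | nil => simp at hj
  | cons k l ih =>
    rw [List.map_cons, List.prod_cons, ← mul_assoc]
    rcases eq_or_ne k j with rfl | h
    · rw [vacantProj, ← mul_assoc (witt p k), witt_mul_self]; simp
    · rw [← (commute_vacantProj_witt p h).eq, mul_assoc,
        ih ((List.mem_cons.mp hj).resolve_left h.symm), mul_zero]

theorem prod_vacantProj_mul (p : ℕ) (j : Fin (2 * p)) (l : List (Fin (2 * p))) (hj : j ∈ l) :
    (l.map (vacantProj p)).prod * wittDag p j = 0 := by
  induction l with
  | nil => simp at hj
  | cons k l ih =>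
    rw [List.map_cons, List.prod_cons, mul_assoc]
    by_cases h : j ∈ l
    · rw [ih h, mul_zero]
    · obtain rfl := (List.mem_cons.mp hj).resolve_right h
      have hc : Commute (l.map (vacantProj p)).prod (wittDag p j) := by
        refine Commute.list_prod_left _ _ fun y hy => ?_
        obtain ⟨k, hk, rfl⟩ := List.mem_map.mp hy
        exact commute_vacantProj_wittDag p (fun e => h (e ▸ hk))
      rw [hc.eq, ← mul_assoc, vacantProj, mul_assoc (witt p j), wittDag_mul_self]; simp

theorem idem_mul_wittDag (p : ℕ) (j : Fin (2 * p)) : idem p * wittDag p j = 0 := by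
  rw [idem_eq]; exact prod_vacantProj_mul p j _ (List.mem_finRange j)

theorem witt_smul_vac (p : ℕ) (j : Fin (2 * p)) : witt p j • vac p = 0 := by
  apply Subtype.ext
  change witt p j * idem p = 0
  rw [idem_eq]; exact mul_prod_vacantProj p j _ (List.mem_finRange j)

section Action

variable {p : ℕ} (x : Spinor p)

theorem witt_smul_wittDag_smul (j : Fin (2 * p)) :
    witt p j • wittDag p j • x = x - wittDag p j • witt p j • x := by
  rw [smul_smul, witt_mul_wittDag_self, sub_smul, one_smul, mul_smul]

theorem witt_smul_wittDag_smul_of_ne {j k : Fin (2 * p)} (h : j ≠ k) :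
    witt p j • wittDag p k • x = -(wittDag p k • witt p j • x) := by
  rw [smul_smul, witt_mul_wittDag_of_ne p h, neg_smul, mul_smul]

theorem witt_smul_witt_smul (j k : Fin (2 * p)) :
    witt p j • witt p k • x = -(witt p k • witt p j • x) := by
  rw [smul_smul, witt_mul_witt, neg_smul, mul_smul]

theorem wittDag_smul_wittDag_smul (j k : Fin (2 * p)) :
    wittDag p j • wittDag p k • x = -(wittDag p k • wittDag p j • x) := by
  rw [smul_smul, wittDag_mul_wittDag, neg_smul, mul_smul]

theorem witt_smul_self (j : Fin (2 * p)) : witt p j • witt p j • x = 0 := by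
  rw [smul_smul, witt_mul_self, zero_smul]

theorem wittDag_smul_self (j : Fin (2 * p)) : wittDag p j • wittDag p j • x = 0 := by
  rw [smul_smul, wittDag_mul_self, zero_smul]

theorem idem_smul_of_annihilated (h : ∀ j, witt p j • x = 0) : idem p • x = x := by
  have key : ∀ l : List (Fin (2 * p)), (l.map (vacantProj p)).prod • x = x := by
    intro l
    induction l with
    | nil => simp
    | cons j l ih =>
      rw [List.map_cons, List.prod_cons, mul_smul, ih, vacantProj, mul_smul,
        witt_smul_wittDag_smul, h, smul_zero, sub_zero]
  exact (congrArg (· • x) (idem_eq p)).trans (key _)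

end Action

/-! ### The grading of spinor space -/

theorem homSpinor_zero (p : ℕ) : homSpinor p 0 = Submodule.span ℂ {vac p} := by
  rw [homSpinor]
  congr 1
  ext y
  simp

theorem homSpinor_succ (p r : ℕ) :
    homSpinor p (r + 1) = ⨆ j, (homSpinor p r).map (Algebra.lsmul ℂ ℂ (Spinor p) (wittDag p j)) := by
  simp only [homSpinor, Submodule.map_span]
  rw [← Submodule.span_iUnion]
  congr 1
  ext y
  simp only [Set.mem_range, Set.mem_iUnion, Set.mem_image]
  constructor
  · rintro ⟨s, rfl⟩
    refine ⟨s 0, _, ⟨fun i => s i.succ, rfl⟩, ?_⟩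
    rw [List.ofFn_succ, List.prod_cons, mul_smul]
    rfl
  · rintro ⟨j, _, ⟨s, rfl⟩, rfl⟩
    refine ⟨Fin.cons j s, ?_⟩
    rw [List.ofFn_succ, List.prod_cons, mul_smul]
    rfl

theorem wittDag_smul_mem {p r : ℕ} {x : Spinor p} (hx : x ∈ homSpinor p r) (j : Fin (2 * p)) :
    wittDag p j • x ∈ homSpinor p (r + 1) := by
  rw [homSpinor_succ]
  exact Submodule.mem_iSup_of_mem j ⟨x, hx, rfl⟩

/-- Induction over the grading. -/
theorem homSpinor_induction {p : ℕ} (C : ℕ → Spinor p → Prop) (hvac : C 0 (vac p))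
    (hdag : ∀ r x, x ∈ homSpinor p r → C r x → ∀ j, C (r + 1) (wittDag p j • x))
    (hzero : ∀ r, C r 0)
    (hadd : ∀ r x y, C r x → C r y → C r (x + y)) (hsmul : ∀ r (c : ℂ) x, C r x → C r (c • x)) :
    ∀ r x, x ∈ homSpinor p r → C r x := by
  intro r
  induction r with
  | zero =>
    intro x hx
    rw [homSpinor_zero, Submodule.mem_span_singleton] at hx
    obtain ⟨c, rfl⟩ := hx
    exact hsmul _ _ _ hvac
  | succ r ih =>
    intro x hx
    rw [homSpinor_succ] at hx
    induction hx using Submodule.iSup_induction' with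
    | mem j y hy =>
      obtain ⟨z, hz, rfl⟩ := hy
      exact hdag _ _ hz (ih _ hz) _
    | zero => exact hzero _
    | add y z _ _ h1 h2 => exact hadd _ _ _ h1 h2

theorem witt_smul_eq_zero {p : ℕ} {x : Spinor p} (hx : x ∈ homSpinor p 0) (j : Fin (2 * p)) :
    witt p j • x = 0 := by
  rw [homSpinor_zero, Submodule.mem_span_singleton] at hx
  obtain ⟨c, rfl⟩ := hx
  rw [smul_comm, witt_smul_vac, smul_zero]

/-- The truncated `r - 1` is harmless: in degree `0` the product vanishes. -/
theorem witt_smul_mem_pred {p : ℕ} (j : Fin (2 * p)) (r : ℕ) (x : Spinor p)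
    (hx : x ∈ homSpinor p r) : witt p j • x ∈ homSpinor p (r - 1) := by
  induction r generalizing x with
  | zero => rw [witt_smul_eq_zero hx]; exact zero_mem _
  | succ r ih =>
    rw [homSpinor_succ] at hx
    induction hx using Submodule.iSup_induction' with
    | mem k y hy =>
      obtain ⟨z, hz, rfl⟩ := hy
      have h : wittDag p k • witt p j • z ∈ homSpinor p r := by
        rcases r with _ | r
        · rw [witt_smul_eq_zero hz, smul_zero]; exact zero_mem _
        · exact wittDag_smul_mem (ih z hz) k
      change witt p j • wittDag p k • z ∈ homSpinor p r
      rcases eq_or_ne j k with rfl | hjk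
      · rw [witt_smul_wittDag_smul]
        exact sub_mem hz h
      · rw [witt_smul_wittDag_smul_of_ne _ hjk]
        exact neg_mem h
    | zero => rw [smul_zero]; exact zero_mem _
    | add y z _ _ h1 h2 => rw [smul_add]; exact add_mem h1 h2

theorem witt_smul_mem {p r : ℕ} {x : Spinor p} (hx : x ∈ homSpinor p (r + 1)) (j : Fin (2 * p)) :
    witt p j • x ∈ homSpinor p r :=
  witt_smul_mem_pred j (r + 1) x hx

/-! ### Generation of spinor space from the vacuum -/

theorem eRe_eq (p : ℕ) (j : Fin (2 * p)) : eRe p j = wittDag p j - witt p j := by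
  rw [wittDag, witt]
  module

theorem eIm_eq (p : ℕ) (j : Fin (2 * p)) :
    eIm p j = (-Complex.I) • (wittDag p j + witt p j) := by
  have h : wittDag p j + witt p j = Complex.I • eIm p j := by
    rw [wittDag, witt]
    module
  rw [h, smul_smul]
  simp

theorem gen_mem_span (p : ℕ) (α : Fin (4 * p)) :
    ∃ (j : Fin (2 * p)) (a b : ℂ), gen p α = a • wittDag p j + b • witt p j := by
  have hα : α.val / 2 < 2 * p := by omega
  rcases Nat.mod_two_eq_zero_or_one α.val with h | h
  · refine ⟨⟨α.val / 2, hα⟩, 1, -1, ?_⟩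
    have h1 : gen p α = eRe p ⟨α.val / 2, hα⟩ := by
      rw [eRe]; congr 1; ext; simp only; omega
    rw [h1, eRe_eq]; module
  · refine ⟨⟨α.val / 2, hα⟩, -Complex.I, -Complex.I, ?_⟩
    have h1 : gen p α = eIm p ⟨α.val / 2, hα⟩ := by
      rw [eIm]; congr 1; ext; simp only; omega
    rw [h1, eIm_eq, smul_add]

/-- A complex subspace stable under the Witt basis is stable under the Clifford algebra. -/
theorem smul_mem_of_witt_stable {p : ℕ} (U : Submodule ℂ (Spinor p))
    (h1 : ∀ j, ∀ x ∈ U, wittDag p j • x ∈ U) (h2 : ∀ j, ∀ x ∈ U, witt p j • x ∈ U) (a : Cl p) :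
    ∀ x ∈ U, a • x ∈ U := by
  induction a using CliffordAlgebra.induction with
  | algebraMap c => intro x hx; rw [algebraMap_smul]; exact U.smul_mem c hx
  | ι v =>
    intro x hx
    have hv : CliffordAlgebra.ι (cliffordForm p) v = ∑ α, v α • gen p α := by
      conv_lhs => rw [pi_eq_sum_univ' v]
      simp [gen]
    rw [hv, Finset.sum_smul]
    refine sum_mem fun α _ => ?_
    obtain ⟨j, a, b, h⟩ := gen_mem_span p α
    rw [h, smul_assoc, add_smul, smul_assoc, smul_assoc]
    exact U.smul_mem _ (add_mem (U.smul_mem _ (h1 j x hx)) (U.smul_mem _ (h2 j x hx)))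
  | mul a b ha hb => intro x hx; rw [mul_smul]; exact ha _ (hb _ hx)
  | add a b ha hb => intro x hx; rw [add_smul]; exact add_mem (ha _ hx) (hb _ hx)

/-- The sum contains `I` and is stable under creation and annihilation, hence under the whole
Clifford algebra. -/
theorem iSup_homSpinor (p : ℕ) : ⨆ r, homSpinor p r = ⊤ := by
  have key := smul_mem_of_witt_stable (⨆ r, homSpinor p r) ?_ ?_
  · rw [eq_top_iff]
    rintro ⟨x, hx⟩ -
    obtain ⟨a, rfl⟩ := Submodule.mem_span_singleton.mp hx
    refine key a (vac p) (Submodule.mem_iSup_of_mem 0 ?_)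
    rw [homSpinor_zero]
    exact Submodule.mem_span_singleton_self _
  · intro j x hx
    induction hx using Submodule.iSup_induction' with
    | mem r y hy => exact Submodule.mem_iSup_of_mem _ (wittDag_smul_mem hy j)
    | zero => rw [smul_zero]; exact zero_mem _
    | add y z _ _ h1 h2 => rw [smul_add]; exact add_mem h1 h2
  · intro j x hx
    induction hx using Submodule.iSup_induction' with
    | mem r y hy =>
      rcases r with _ | r
      · rw [witt_smul_eq_zero hy]; exact zero_mem _
      · exact Submodule.mem_iSup_of_mem _ (witt_smul_mem hy j)
    | zero => rw [smul_zero]; exact zero_mem _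
    | add y z _ _ h1 h2 => rw [smul_add]; exact add_mem h1 h2

/-- Such a vector equals `I x`, and `I` maps all of spinor space into `ℂ I` because `I 𝔣_j† = 0`. -/
theorem mem_span_vac_of_annihilated {p : ℕ} (x : Spinor p) (h : ∀ j, witt p j • x = 0) :
    x ∈ Submodule.span ℂ {vac p} := by
  rw [← idem_smul_of_annihilated x h]
  have hx : x ∈ ⨆ r, homSpinor p r := by rw [iSup_homSpinor]; trivial
  -- The claim about `I x` holds for every `x`; the annihilation hypothesis would not survive the
  -- induction.
  clear h
  induction hx using Submodule.iSup_induction' with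
  | mem r y hy =>
    refine homSpinor_induction (fun _ y => idem p • y ∈ Submodule.span ℂ {vac p})
      ?_ ?_ ?_ ?_ ?_ r y hy
    · rw [idem_smul_of_annihilated _ (witt_smul_vac p)]
      exact Submodule.mem_span_singleton_self _
    · intro r x _ _ j
      rw [smul_smul, idem_mul_wittDag, zero_smul]; exact zero_mem _
    · intro r; rw [smul_zero]; exact zero_mem _
    · intro r x y h1 h2; rw [smul_add]; exact add_mem h1 h2
    · intro r c x h1; rw [smul_comm]; exact Submodule.smul_mem _ _ h1
  | zero => rw [smul_zero]; exact zero_mem _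
  | add y z _ _ h1 h2 => rw [smul_add]; exact add_mem h1 h2

instance finiteDimensional_homSpinor (p r : ℕ) : FiniteDimensional ℂ (homSpinor p r) :=
  FiniteDimensional.span_of_finite ℂ (Set.finite_range _)

/-! ### Pairs of labels and the symplectic form -/

theorem oddIdx_injective (p : ℕ) : Function.Injective (oddIdx p) := fun i j h => by
  simp only [oddIdx, Fin.mk.injEq] at h; ext; omega

theorem evenIdx_injective (p : ℕ) : Function.Injective (evenIdx p) := fun i j h => by
  simp only [evenIdx, Fin.mk.injEq] at h; ext; omega

theorem oddIdx_ne_evenIdx (p : ℕ) (i j : Fin p) : oddIdx p i ≠ evenIdx p j := by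
  simp only [oddIdx, evenIdx, ne_eq, Fin.mk.injEq]; omega

theorem idx_cases (p : ℕ) (a : Fin (2 * p)) : (∃ k, a = oddIdx p k) ∨ ∃ k, a = evenIdx p k := by
  rcases Nat.mod_two_eq_zero_or_one a.val with h | h
  · exact Or.inl ⟨⟨a.val / 2, by omega⟩, by ext; simp only [oddIdx]; omega⟩
  · exact Or.inr ⟨⟨a.val / 2, by omega⟩, by ext; simp only [evenIdx]; omega⟩

theorem sum_idx {M : Type*} [AddCommMonoid M] (p : ℕ) (F : Fin (2 * p) → M) :
    ∑ a, F a = ∑ k, (F (oddIdx p k) + F (evenIdx p k)) := by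
  have hb : Function.Bijective (Sum.elim (oddIdx p) (evenIdx p)) := by
    refine ⟨(oddIdx_injective p).sumElim (evenIdx_injective p) (oddIdx_ne_evenIdx p), fun a => ?_⟩
    rcases idx_cases p a with ⟨k, rfl⟩ | ⟨k, rfl⟩
    · exact ⟨Sum.inl k, rfl⟩
    · exact ⟨Sum.inr k, rfl⟩
  rw [Finset.sum_add_distrib, ← hb.sum_comp F, Fintype.sum_sum_type]
  rfl

/-- The other label in the pair of `a`. -/
def partner (p : ℕ) (a : Fin (2 * p)) : Fin (2 * p) :=
  ⟨if a.val % 2 = 0 then a.val + 1 else a.val - 1, by split_ifs <;> omega⟩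

/-- The sign `1` on odd and `-1` on even labels. -/
noncomputable def idxSign (p : ℕ) (a : Fin (2 * p)) : ℂ := if a.val % 2 = 0 then 1 else -1

@[simp] theorem partner_oddIdx (p : ℕ) (k : Fin p) : partner p (oddIdx p k) = evenIdx p k := by
  simp [partner, oddIdx, evenIdx]

@[simp] theorem partner_evenIdx (p : ℕ) (k : Fin p) : partner p (evenIdx p k) = oddIdx p k := by
  simp [partner, oddIdx, evenIdx]

@[simp] theorem idxSign_oddIdx (p : ℕ) (k : Fin p) : idxSign p (oddIdx p k) = 1 := by
  simp [idxSign, oddIdx]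

@[simp] theorem idxSign_evenIdx (p : ℕ) (k : Fin p) : idxSign p (evenIdx p k) = -1 := by
  simp [idxSign, evenIdx]

@[simp] theorem partner_partner (p : ℕ) (a : Fin (2 * p)) : partner p (partner p a) = a := by
  rcases idx_cases p a with ⟨k, rfl⟩ | ⟨k, rfl⟩ <;> simp

@[simp] theorem idxSign_partner (p : ℕ) (a : Fin (2 * p)) :
    idxSign p (partner p a) = -idxSign p a := by
  rcases idx_cases p a with ⟨k, rfl⟩ | ⟨k, rfl⟩ <;> simp

theorem idxSign_mul_self (p : ℕ) (a : Fin (2 * p)) : idxSign p a * idxSign p a = 1 := by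
  rcases idx_cases p a with ⟨k, rfl⟩ | ⟨k, rfl⟩ <;> simp

theorem partner_involutive (p : ℕ) : Function.Involutive (partner p) := partner_partner p

theorem formMatrix_apply (p : ℕ) (a b : Fin (2 * p)) :
    formMatrix p a b = if b = partner p a then idxSign p a else 0 := by
  rw [formMatrix, Matrix.sum_apply]
  rcases idx_cases p a with ⟨k, rfl⟩ | ⟨k, rfl⟩
  · simp only [Matrix.sub_apply, Matrix.single_apply, (oddIdx_injective p).eq_iff,
      (oddIdx_ne_evenIdx p _ _).symm, partner_oddIdx, idxSign_oddIdx]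
    rw [Finset.sum_eq_single k] <;> simp +contextual [eq_comm]
  · simp only [Matrix.sub_apply, Matrix.single_apply, (evenIdx_injective p).eq_iff,
      oddIdx_ne_evenIdx p _ _, partner_evenIdx, idxSign_evenIdx]
    rw [Finset.sum_eq_single k] <;> simp +contextual [eq_comm, neg_ite]

/-- Entrywise form of the symmetry of `JA`. -/
theorem mem_sp_iff_apply (p : ℕ) (A : Matrix (Fin (2 * p)) (Fin (2 * p)) ℂ) :
    A ∈ sp p ↔ ∀ a b, idxSign p a * A (partner p a) b = idxSign p b * A (partner p b) a := by
  have h : ∀ a b, (A.transpose * formMatrix p + formMatrix p * A) a b =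
      idxSign p a * A (partner p a) b - idxSign p b * A (partner p b) a := by
    intro a b
    simp only [Matrix.add_apply, Matrix.mul_apply, formMatrix_apply, Matrix.transpose_apply]
    rw [Finset.sum_eq_single (partner p b), Finset.sum_eq_single (partner p a)]
    · simp; ring
    · intro c _ hc; simp [hc]
    · simp
    · intro c _ hc
      rw [if_neg, mul_zero]
      rintro rfl
      simp at hc
    · simp
  rw [mem_sp_iff, ← Matrix.ext_iff]
  simp only [h, Matrix.zero_apply, sub_eq_zero]

/-- Since `J² = -1`, symmetry of `JA` is equivalent to symmetry of `AJ`; this is read off at the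
partner labels. -/
theorem transpose_apply_of_mem_sp {p : ℕ} {A : Matrix (Fin (2 * p)) (Fin (2 * p)) ℂ}
    (hA : A ∈ sp p) (a b : Fin (2 * p)) :
    idxSign p b * A a (partner p b) = idxSign p a * A b (partner p a) := by
  have h := (mem_sp_iff_apply p A).mp hA (partner p a) (partner p b)
  simp only [partner_partner, idxSign_partner] at h
  linear_combination (-(idxSign p a * idxSign p b)) * h +
    (idxSign p b * A a (partner p b)) * (-idxSign_mul_self p a) -
    (idxSign p a * A b (partner p a)) * (-idxSign_mul_self p b)

theorem transpose_mem_sp {p : ℕ} {A : Matrix (Fin (2 * p)) (Fin (2 * p)) ℂ}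
    (hA : A ∈ sp p) : A.transpose ∈ sp p := by
  rw [mem_sp_iff_apply]
  exact fun a b => transpose_apply_of_mem_sp hA b a

/-! ### Invariance of `P` and `Q` -/

theorem sum_symm_smul_eq_zero {ι A : Type*} [Fintype ι] [Ring A] [Algebra ℂ A] (B : ι → ι → ℂ)
    (g : ι → A) (hB : ∀ a b, B a b = B b a) (hg : ∀ a b, g a * g b = -(g b * g a)) :
    ∑ a, ∑ b, B a b • (g a * g b) = 0 := by
  apply eq_zero_of_eq_neg_self
  conv_lhs => rw [Finset.sum_comm]
  rw [← Finset.sum_neg_distrib]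
  refine Finset.sum_congr rfl fun a _ => ?_
  rw [← Finset.sum_neg_distrib]
  refine Finset.sum_congr rfl fun b _ => ?_
  rw [hB, hg, smul_neg]

/-- The element `P` of the Clifford algebra. -/
noncomputable def clP (p : ℕ) : Cl p := ∑ k : Fin p, witt p (evenIdx p k) * witt p (oddIdx p k)

/-- The element `Q` of the Clifford algebra. -/
noncomputable def clQ (p : ℕ) : Cl p :=
  ∑ k : Fin p, wittDag p (oddIdx p k) * wittDag p (evenIdx p k)

theorem opP_apply (p : ℕ) (x : Spinor p) : opP p x = clP p • x := rfl

theorem opQ_apply (p : ℕ) (x : Spinor p) : opQ p x = clQ p • x := rfl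

theorem realize_apply (p : ℕ) (A : Matrix (Fin (2 * p)) (Fin (2 * p)) ℂ) :
    realize p A = ∑ j, ∑ k, A j k • (wittDag p j * witt p k) := rfl

theorem realize_mul_wittDag (p : ℕ) (A : Matrix (Fin (2 * p)) (Fin (2 * p)) ℂ)
    (l : Fin (2 * p)) :
    realize p A * wittDag p l = wittDag p l * realize p A + ∑ j, A j l • wittDag p j := by
  have h : ∀ j k, wittDag p j * witt p k * wittDag p l =
      wittDag p l * (wittDag p j * witt p k) + (if k = l then wittDag p j else 0) := by
    intro j k
    rw [mul_assoc, witt_mul_wittDag, mul_sub, ← mul_assoc, wittDag_mul_wittDag p j l, neg_mul,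
      sub_neg_eq_add, add_comm, mul_assoc]
    congr 1
    split_ifs <;> simp
  rw [realize_apply, Finset.sum_mul, Finset.mul_sum, ← Finset.sum_add_distrib]
  refine Finset.sum_congr rfl fun j _ => ?_
  rw [Finset.sum_mul, Finset.mul_sum]
  simp only [smul_mul_assoc, mul_smul_comm, h, smul_add, Finset.sum_add_distrib]
  simp

theorem realize_mul_witt (p : ℕ) (A : Matrix (Fin (2 * p)) (Fin (2 * p)) ℂ)
    (l : Fin (2 * p)) :
    realize p A * witt p l = witt p l * realize p A - ∑ k, A l k • witt p k := by
  have h : ∀ j k, wittDag p j * witt p k * witt p l =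
      witt p l * (wittDag p j * witt p k) - (if l = j then witt p k else 0) := by
    intro j k
    rw [← mul_assoc, witt_mul_wittDag, sub_mul, mul_assoc, mul_assoc, witt_mul_witt p k l, mul_neg]
    split_ifs <;> simp
  rw [realize_apply, Finset.sum_comm, Finset.sum_mul, Finset.mul_sum, ← Finset.sum_sub_distrib]
  refine Finset.sum_congr rfl fun j _ => ?_
  rw [Finset.sum_mul, Finset.mul_sum]
  simp only [smul_mul_assoc, mul_smul_comm, h, smul_sub, Finset.sum_sub_distrib]
  simp

/-- The commutator with `Q` is a contraction of the matrix `AJ`, symmetric by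
`transpose_apply_of_mem_sp`, with the anticommuting products `𝔣_a† 𝔣_b†`, and so vanishes. -/
theorem realize_commute_clQ {p : ℕ} {A : Matrix (Fin (2 * p)) (Fin (2 * p)) ℂ} (hA : A ∈ sp p) :
    Commute (realize p A) (clQ p) := by
  set u : Fin (2 * p) → Cl p := fun l => ∑ j, A j l • wittDag p j with hu
  have hanti : ∀ l m, wittDag p m * u l = -(u l * wittDag p m) := by
    intro l m
    simp only [hu, Finset.mul_sum, Finset.sum_mul, mul_smul_comm, smul_mul_assoc,
      ← Finset.sum_neg_distrib]
    exact Finset.sum_congr rfl fun j _ => by rw [wittDag_mul_wittDag, smul_neg]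
  have h1 : realize p A * clQ p = clQ p * realize p A +
      ∑ l, idxSign p l • (u l * wittDag p (partner p l)) := by
    rw [sum_idx, clQ, Finset.mul_sum, Finset.sum_mul, ← Finset.sum_add_distrib]
    refine Finset.sum_congr rfl fun k _ => ?_
    rw [← mul_assoc, realize_mul_wittDag, add_mul, mul_assoc, realize_mul_wittDag, mul_add]
    change _ + _ * u _ + u _ * _ = _
    rw [hanti]
    simp only [idxSign_oddIdx, idxSign_evenIdx, partner_oddIdx, partner_evenIdx, one_smul, neg_smul]
    rw [mul_assoc]
    abel
  have h2 : ∑ l, idxSign p l • (u l * wittDag p (partner p l)) = 0 := by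
    rw [← (partner_involutive p).bijective.sum_comp]
    simp only [hu, partner_partner, idxSign_partner, Finset.sum_mul, smul_mul_assoc,
      Finset.smul_sum, smul_smul]
    rw [Finset.sum_comm]
    refine sum_symm_smul_eq_zero (fun a b => -idxSign p b * A a (partner p b)) _ (fun a b => ?_)
      (wittDag_mul_wittDag p)
    rw [neg_mul, neg_mul, transpose_apply_of_mem_sp hA]
  rw [Commute, SemiconjBy, h1, h2, add_zero]

/-- Dual to `realize_commute_clQ`: here the symmetric matrix `JA` is contracted with the products
`𝔣_a 𝔣_b`. -/
theorem realize_commute_clP {p : ℕ} {A : Matrix (Fin (2 * p)) (Fin (2 * p)) ℂ} (hA : A ∈ sp p) :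
    Commute (realize p A) (clP p) := by
  set w : Fin (2 * p) → Cl p := fun l => ∑ k, A l k • witt p k with hw
  have hanti : ∀ l m, w l * witt p m = -(witt p m * w l) := by
    intro l m
    simp only [hw, Finset.mul_sum, Finset.sum_mul, mul_smul_comm, smul_mul_assoc,
      ← Finset.sum_neg_distrib]
    exact Finset.sum_congr rfl fun j _ => by rw [witt_mul_witt, smul_neg]
  have h1 : realize p A * clP p = clP p * realize p A -
      ∑ l, idxSign p l • (witt p (partner p l) * w l) := by
    rw [sum_idx, clP, Finset.mul_sum, Finset.sum_mul, ← Finset.sum_sub_distrib]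
    refine Finset.sum_congr rfl fun k _ => ?_
    rw [← mul_assoc, realize_mul_witt, sub_mul, mul_assoc, realize_mul_witt, mul_sub]
    change _ - _ * w _ - w _ * _ = _
    rw [hanti]
    simp only [idxSign_oddIdx, idxSign_evenIdx, partner_oddIdx, partner_evenIdx, one_smul, neg_smul]
    rw [mul_assoc]
    abel
  have h2 : ∑ l, idxSign p l • (witt p (partner p l) * w l) = 0 := by
    rw [← (partner_involutive p).bijective.sum_comp]
    simp only [hw, partner_partner, idxSign_partner, Finset.mul_sum, mul_smul_comm,
      Finset.smul_sum, smul_smul]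
    refine sum_symm_smul_eq_zero (fun a b => -idxSign p a * A (partner p a) b) _ (fun a b => ?_)
      (witt_mul_witt p)
    rw [neg_mul, neg_mul, (mem_sp_iff_apply p A).mp hA]
  rw [Commute, SemiconjBy, h1, h2, sub_zero]

theorem lie_spinor (p : ℕ) (A : sp p) (x : Spinor p) : ⁅A, x⁆ = realize p A.1 • x := rfl

theorem opP_lie (p : ℕ) (A : sp p) (x : Spinor p) : opP p ⁅A, x⁆ = ⁅A, opP p x⁆ := by
  rw [lie_spinor, lie_spinor, opP_apply, opP_apply, smul_smul, smul_smul,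
    (realize_commute_clP A.2).eq]

theorem opQ_lie (p : ℕ) (A : sp p) (x : Spinor p) : opQ p ⁅A, x⁆ = ⁅A, opQ p x⁆ := by
  rw [lie_spinor, lie_spinor, opQ_apply, opQ_apply, smul_smul, smul_smul,
    (realize_commute_clQ A.2).eq]

theorem opQ_pow_lie (p k : ℕ) (A : sp p) (x : Spinor p) :
    (opQ p ^ k) ⁅A, x⁆ = ⁅A, (opQ p ^ k) x⁆ := by
  induction k with
  | zero => simp
  | succ k ih => rw [pow_succ', Module.End.mul_apply, ih, opQ_lie, Module.End.mul_apply]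

theorem lie_mem_homSpinor {p r : ℕ} (A : sp p) {x : Spinor p} (hx : x ∈ homSpinor p r) :
    ⁅A, x⁆ ∈ homSpinor p r := by
  rw [lie_spinor, realize_apply, Finset.sum_smul]
  refine sum_mem fun j _ => ?_
  rw [Finset.sum_smul]
  refine sum_mem fun k _ => ?_
  rw [smul_assoc, mul_smul]
  refine Submodule.smul_mem _ _ ?_
  rcases r with _ | r
  · rw [witt_smul_eq_zero hx, smul_zero]; exact zero_mem _
  · exact wittDag_smul_mem (witt_smul_mem hx k) j

/-! ### The complex structure of spinor space -/

section ScalarAction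

variable {p : ℕ} (c d : ℂ) (x y : Spinor p)

theorem cadd_smul : (c + d) • x = c • x + d • x := add_smul c d x

theorem csub_smul : (c - d) • x = c • x - d • x := sub_smul c d x

theorem cmul_smul : (c * d) • x = c • d • x := mul_smul c d x

theorem csmul_add : c • (x + y) = c • x + c • y := smul_add c x y

theorem cnat_smul (n : ℕ) : (n : ℂ) • x = n • x := Nat.cast_smul_eq_nsmul ℂ n x

theorem csmul_sum {ι : Type*} (s : Finset ι) (f : ι → Spinor p) :
    c • ∑ i ∈ s, f i = ∑ i ∈ s, c • f i :=
  Finset.smul_sum (r := c) (f := f) (s := s)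

theorem csmul_comm (a : Cl p) : a • c • x = c • a • x := smul_comm a c x

theorem czero_smul : (0 : ℂ) • x = 0 := zero_smul ℂ x

theorem cneg_one_smul : (-1 : ℂ) • x = -x := neg_one_smul ℂ x

theorem cone_smul : (1 : ℂ) • x = x := one_smul ℂ x

theorem csmul_zero : c • (0 : Spinor p) = 0 := smul_zero (A := Spinor p) c

end ScalarAction

/-! ### The commutation relations of `P`, `Q` and the number operator -/

theorem sum_occProj_smul {p r : ℕ} {x : Spinor p} (hx : x ∈ homSpinor p r) :
    ∑ a, occProj p a • x = (r : ℂ) • x := by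
  refine homSpinor_induction (fun r x => ∑ a, occProj p a • x = (r : ℂ) • x)
      ?_ ?_ ?_ ?_ ?_ r x hx
  · simp [occProj, mul_smul, witt_smul_vac, czero_smul]
  · intro r x _ ih j
    have h : ∀ a, occProj p a • wittDag p j • x =
        wittDag p j • occProj p a • x + (if a = j then wittDag p a • x else 0) := by
      intro a
      simp only [occProj, mul_smul]
      split_ifs with h
      · subst h
        rw [witt_smul_wittDag_smul, smul_sub, wittDag_smul_self, sub_zero, zero_add]
      · rw [witt_smul_wittDag_smul_of_ne _ h, smul_neg, wittDag_smul_wittDag_smul, neg_neg,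
          add_zero]
    simp only [h, Finset.sum_add_distrib, ← Finset.smul_sum, ih]
    rw [smul_comm]
    push_cast
    rw [cadd_smul, cone_smul]
    simp
  · intro r; simp [csmul_zero]
  · intro r x y h1 h2; simp only [smul_add, csmul_add, Finset.sum_add_distrib, h1, h2]
  · intro r c x h1
    simp only [csmul_comm]
    rw [← csmul_sum, h1, ← cmul_smul, ← cmul_smul, mul_comm c]

theorem clP_mul_wittDag_oddIdx (p : ℕ) (l : Fin p) :
    clP p * wittDag p (oddIdx p l) = wittDag p (oddIdx p l) * clP p + witt p (evenIdx p l) := by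
  have h : ∀ k, witt p (evenIdx p k) * witt p (oddIdx p k) * wittDag p (oddIdx p l) =
      wittDag p (oddIdx p l) * (witt p (evenIdx p k) * witt p (oddIdx p k)) +
        (if k = l then witt p (evenIdx p k) else 0) := by
    intro k
    rw [mul_assoc, witt_mul_wittDag, mul_sub, ← mul_assoc,
      witt_mul_wittDag_of_ne p (oddIdx_ne_evenIdx p _ _).symm, neg_mul, sub_neg_eq_add, add_comm,
      mul_assoc]
    simp only [(oddIdx_injective p).eq_iff]
    split_ifs <;> simp
  simp only [clP, Finset.sum_mul, Finset.mul_sum, h, Finset.sum_add_distrib]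
  simp

theorem clP_mul_wittDag_evenIdx (p : ℕ) (l : Fin p) :
    clP p * wittDag p (evenIdx p l) = wittDag p (evenIdx p l) * clP p - witt p (oddIdx p l) := by
  have h : ∀ k, witt p (evenIdx p k) * witt p (oddIdx p k) * wittDag p (evenIdx p l) =
      wittDag p (evenIdx p l) * (witt p (evenIdx p k) * witt p (oddIdx p k)) -
        (if k = l then witt p (oddIdx p k) else 0) := by
    intro k
    rw [mul_assoc, witt_mul_wittDag_of_ne p (oddIdx_ne_evenIdx p _ _), mul_neg, ← mul_assoc,
      witt_mul_wittDag, sub_mul, neg_sub, mul_assoc]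
    simp only [(evenIdx_injective p).eq_iff]
    split_ifs <;> simp
  simp only [clP, Finset.sum_mul, Finset.mul_sum, h, Finset.sum_sub_distrib]
  simp

/-- Each pair of labels contributes `1` minus the occupation numbers of its two members; summing
over the `p` pairs gives `p` minus the number operator. -/
theorem opP_opQ {p r : ℕ} {x : Spinor p} (hx : x ∈ homSpinor p r) :
    opP p (opQ p x) = opQ p (opP p x) + ((p : ℂ) - r) • x := by
  have h : ∀ k, clP p • (wittDag p (oddIdx p k) * wittDag p (evenIdx p k)) • x =
      (wittDag p (oddIdx p k) * wittDag p (evenIdx p k)) • clP p • x + x -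
        (occProj p (oddIdx p k) • x + occProj p (evenIdx p k) • x) := by
    intro k
    rw [smul_smul, ← mul_assoc, clP_mul_wittDag_oddIdx, add_mul, mul_assoc,
      clP_mul_wittDag_evenIdx, witt_mul_wittDag_self, occProj, occProj, ← smul_assoc, smul_eq_mul]
    simp only [add_smul, sub_smul, mul_sub, one_smul, mul_assoc]
    abel
  rw [opP_apply, opP_apply, opQ_apply, opQ_apply, csub_smul, ← sum_occProj_smul hx, sum_idx]
  simp only [clQ, Finset.sum_smul, Finset.smul_sum, h, Finset.sum_sub_distrib,
    Finset.sum_add_distrib, Finset.sum_const, Finset.card_univ, Fintype.card_fin]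
  rw [cnat_smul]
  abel

theorem opQ_mem {p r : ℕ} {x : Spinor p} (hx : x ∈ homSpinor p r) :
    opQ p x ∈ homSpinor p (r + 2) := by
  rw [opQ_apply, clQ, Finset.sum_smul]
  refine sum_mem fun k _ => ?_
  rw [mul_smul]
  exact wittDag_smul_mem (wittDag_smul_mem hx _) _

theorem opQ_pow_mem {p r : ℕ} (k : ℕ) {x : Spinor p} (hx : x ∈ homSpinor p r) :
    (opQ p ^ k) x ∈ homSpinor p (r + 2 * k) := by
  induction k with
  | zero => simpa using hx
  | succ k ih =>
    rw [pow_succ', Module.End.mul_apply]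
    exact opQ_mem ih

theorem opP_mem {p r : ℕ} {x : Spinor p} (hx : x ∈ homSpinor p (r + 2)) :
    opP p x ∈ homSpinor p r := by
  rw [opP_apply, clP, Finset.sum_smul]
  refine sum_mem fun k _ => ?_
  rw [mul_smul]
  exact witt_smul_mem (witt_smul_mem hx _) _

theorem opP_eq_zero {p r : ℕ} (hr : r < 2) {x : Spinor p} (hx : x ∈ homSpinor p r) :
    opP p x = 0 := by
  rw [opP_apply, clP, Finset.sum_smul]
  refine Finset.sum_eq_zero fun k _ => ?_
  rw [mul_smul]
  interval_cases r
  · rw [witt_smul_eq_zero hx, smul_zero]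
  · exact witt_smul_eq_zero (witt_smul_mem hx _) _

theorem opP_pow_mem {p r : ℕ} (k : ℕ) {x : Spinor p} (hx : x ∈ homSpinor p (r + 2 * k)) :
    (opP p ^ k) x ∈ homSpinor p r := by
  induction k generalizing x with
  | zero => simpa using hx
  | succ k ih =>
    rw [pow_succ, Module.End.mul_apply]
    exact ih (opP_mem hx)

theorem opP_pow_eq_zero {p r : ℕ} (k : ℕ) (hk : r < 2 * k) {x : Spinor p}
    (hx : x ∈ homSpinor p r) : (opP p ^ k) x = 0 := by
  induction k generalizing x r with
  | zero => omega
  | succ k ih =>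
    rw [pow_succ, Module.End.mul_apply]
    rcases lt_or_ge r 2 with h | h
    · rw [opP_eq_zero h hx, map_zero]
    · obtain ⟨s, rfl⟩ := Nat.exists_eq_add_of_le' h
      exact ih (by omega) (opP_mem hx)

/-- Commuting `P` past each `Q` in turn gives `∑_{i ≤ j} (p - s - 2i)`, which is `(j + 1)(p - s -
j)`. -/
theorem opP_opQ_pow {p s : ℕ} {y : Spinor p} (hy : y ∈ primitivePart p s) (j : ℕ) :
    opP p ((opQ p ^ (j + 1)) y) = (((j : ℂ) + 1) * (p - s - j)) • (opQ p ^ j) y := by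
  induction j with
  | zero =>
    have h := opP_opQ hy.1
    rw [LinearMap.mem_ker.mp hy.2, map_zero, zero_add] at h
    simpa using h
  | succ j ih =>
    rw [pow_succ', Module.End.mul_apply, opP_opQ (opQ_pow_mem (j + 1) hy.1), ih, map_smul,
      ← Module.End.mul_apply, ← pow_succ', ← cadd_smul]
    congr 1
    push_cast
    ring

theorem exists_opP_pow_opQ_pow {p s : ℕ} {y : Spinor p} (hy : y ∈ primitivePart p s) (m : ℕ)
    (hm : s + m ≤ p) : ∃ c : ℂ, c ≠ 0 ∧ (opP p ^ m) ((opQ p ^ m) y) = c • y := by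
  induction m with
  | zero => exact ⟨1, one_ne_zero, by simp [cone_smul]⟩
  | succ m ih =>
    obtain ⟨c, hc, h⟩ := ih (by omega)
    refine ⟨(((m : ℂ) + 1) * (p - s - m)) * c, mul_ne_zero (mul_ne_zero ?_ ?_) hc, ?_⟩
    · exact_mod_cast Nat.succ_ne_zero m
    · have h2 : (p : ℂ) - s - m = ((p - s - m : ℕ) : ℂ) := by
        rw [Nat.sub_sub, Nat.cast_sub (by omega)]
        push_cast; ring
      rw [h2, Nat.cast_ne_zero]
      omega
    · rw [pow_succ (opP p), Module.End.mul_apply, opP_opQ_pow hy, map_smul, h, ← cmul_smul]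

/-! ### Decomposition of `𝕊^r` into cells -/

theorem cell_le_homSpinor (p s k : ℕ) : cell p s k ≤ homSpinor p (s + 2 * k) := by
  rintro _ ⟨y, hy, rfl⟩
  exact opQ_pow_mem k hy.1

/-- If `P^{m+1} x = 0`, then `y = P^m x` is primitive and `P^m Q^m y = c y` with `c ≠ 0`. Hence `x -
c⁻¹ Q^m y` is killed already by `P^m`, while `Q^m y` lies in a cell. -/
theorem mem_iSup_cell {p r : ℕ} (hr : r ≤ p) (m : ℕ) :
    ∀ x ∈ homSpinor p r, (opP p ^ m) x = 0 →
      x ∈ ⨆ j : Fin (r / 2 + 1), cell p (r - 2 * j.val) j.val := by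
  induction m with
  | zero =>
    intro x _ h
    rw [pow_zero, Module.End.one_apply] at h
    rw [h]; exact zero_mem _
  | succ m ih =>
    intro x hx h
    rcases lt_or_ge r (2 * m) with hm | hm
    · exact ih x hx (opP_pow_eq_zero m hm hx)
    · obtain ⟨s, rfl⟩ := Nat.exists_eq_add_of_le' hm
      have hy : (opP p ^ m) x ∈ primitivePart p s := by
        refine ⟨opP_pow_mem m hx, ?_⟩
        rw [SetLike.mem_coe, LinearMap.mem_ker, ← Module.End.mul_apply, ← pow_succ', h]
      obtain ⟨c, hc, hcy⟩ := exists_opP_pow_opQ_pow hy m (by omega)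
      have h1 : (opQ p ^ m) ((opP p ^ m) x) ∈
          ⨆ j : Fin ((s + 2 * m) / 2 + 1), cell p (s + 2 * m - 2 * j.val) j.val := by
        refine Submodule.mem_iSup_of_mem ⟨m, by omega⟩ ?_
        simp only [Nat.add_sub_cancel]
        exact ⟨_, hy, rfl⟩
      have h2 := ih (x - c⁻¹ • (opQ p ^ m) ((opP p ^ m) x))
        (sub_mem hx (Submodule.smul_mem _ _ (opQ_pow_mem m hy.1))) (by
          rw [map_sub, map_smul, hcy, ← cmul_smul, inv_mul_cancel₀ hc, cone_smul, sub_self])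
      have h3 := add_mem h2 (Submodule.smul_mem _ c⁻¹ h1)
      rwa [sub_add_cancel] at h3

theorem iSup_cell {p r : ℕ} (hr : r ≤ p) :
    (⨆ j : Fin (r / 2 + 1), cell p (r - 2 * j.val) j.val) = homSpinor p r := by
  apply le_antisymm
  · refine iSup_le fun j => ?_
    have h := cell_le_homSpinor p (r - 2 * j.val) j.val
    rwa [Nat.sub_add_cancel (by omega)] at h
  · exact fun x hx => mem_iSup_cell hr (r + 1) x hx (opP_pow_eq_zero _ (by omega) hx)

theorem cell_le_eigenspace (p s j : ℕ) :
    cell p s j ≤ Module.End.eigenspace (opQ p * opP p) ((j : ℂ) * (p - s - j + 1)) := by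
  rintro _ ⟨y, hy, rfl⟩
  rw [Module.End.mem_eigenspace_iff, Module.End.mul_apply]
  rcases j with _ | j
  · rw [pow_zero, Module.End.one_apply, LinearMap.mem_ker.mp hy.2]
    simp [czero_smul]
  · rw [opP_opQ_pow hy, map_smul, ← Module.End.mul_apply, ← pow_succ']
    congr 1
    push_cast
    ring

theorem iSupIndep_cell {p r : ℕ} (hr : r ≤ p) :
    iSupIndep (fun j : Fin (r / 2 + 1) => cell p (r - 2 * j.val) j.val) := by
  -- This is the eigenvalue `j (p - s - j + 1)` of `QP` at `s = r - 2j`. As `r ≤ p`, it is strictly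
  -- increasing in `j`.
  let μ : Fin (r / 2 + 1) → ℂ := fun j => ((j.val * (p - r + j.val + 1) : ℕ) : ℂ)
  have hμ : Function.Injective μ := by
    intro i j h
    have h2 : i.val * (p - r + i.val + 1) = j.val * (p - r + j.val + 1) := Nat.cast_injective h
    ext
    rcases lt_trichotomy i.val j.val with h3 | h3 | h3
    · nlinarith
    · exact h3
    · nlinarith
  refine ((Module.End.eigenspaces_iSupIndep (opQ p * opP p)).comp hμ).mono fun j => ?_
  have h := cell_le_eigenspace p (r - 2 * j.val) j.val
  have h2 : (j.val : ℂ) * (p - (r - 2 * j.val : ℕ) - j.val + 1) = μ j := by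
    simp only [μ]
    rw [Nat.cast_sub (by omega)]
    push_cast [Nat.cast_sub hr]
    ring
  rwa [h2] at h

/-! ### The transposition of the Clifford algebra -/

/-- The isometry of `ℂ^{4p}` that exchanges `𝔣_j` and `𝔣_j†`. -/
noncomputable def flip (p : ℕ) : cliffordForm p →qᵢ cliffordForm p where
  toFun v := fun α => if α.val % 2 = 0 then -v α else v α
  map_add' v w := by
    ext α
    simp only [Pi.add_apply]
    split_ifs <;> ring
  map_smul' c v := by
    ext α
    simp
  map_app' v := by
    simp only [cliffordForm, QuadraticMap.weightedSumSquares_apply]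
    refine Finset.sum_congr rfl fun α _ => ?_
    split_ifs <;> simp

/-- The anti-automorphism of the Clifford algebra that exchanges `𝔣_j` and `𝔣_j†`. -/
noncomputable def transp (p : ℕ) : Cl p →ₗ[ℂ] Cl p :=
  CliffordAlgebra.reverse ∘ₗ (CliffordAlgebra.map (flip p)).toLinearMap

theorem transp_mul (p : ℕ) (a b : Cl p) : transp p (a * b) = transp p b * transp p a := by
  simp [transp, CliffordAlgebra.reverse.map_mul]

theorem transp_one (p : ℕ) : transp p 1 = 1 := by
  simp [transp]

theorem transp_gen (p : ℕ) (α : Fin (4 * p)) :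
    transp p (gen p α) = if α.val % 2 = 0 then -gen p α else gen p α := by
  have h : flip p (Pi.single α 1) =
      if α.val % 2 = 0 then -(Pi.single α 1 : Fin (4 * p) → ℂ) else Pi.single α 1 := by
    ext β
    change (if β.val % 2 = 0 then _ else _) = _
    rcases eq_or_ne β α with rfl | h
    · split_ifs <;> simp
    · split_ifs <;> simp [h]
  rw [transp, LinearMap.comp_apply, gen, AlgHom.toLinearMap_apply, CliffordAlgebra.map_apply_ι, h]
  split_ifs <;> simp

theorem transp_eRe (p : ℕ) (j : Fin (2 * p)) : transp p (eRe p j) = -eRe p j := by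
  rw [eRe, transp_gen, if_pos]; simp

theorem transp_eIm (p : ℕ) (j : Fin (2 * p)) : transp p (eIm p j) = eIm p j := by
  rw [eIm, transp_gen, if_neg]; simp

theorem transp_witt (p : ℕ) (j : Fin (2 * p)) : transp p (witt p j) = wittDag p j := by
  rw [witt, wittDag, map_smul, map_sub, map_smul, transp_eRe, transp_eIm]
  module

theorem transp_wittDag (p : ℕ) (j : Fin (2 * p)) : transp p (wittDag p j) = witt p j := by
  rw [witt, wittDag, map_smul, map_add, map_smul, transp_eRe, transp_eIm]
  module

theorem transp_vacantProj (p : ℕ) (j : Fin (2 * p)) :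
    transp p (vacantProj p j) = vacantProj p j := by
  rw [vacantProj, transp_mul, transp_witt, transp_wittDag]

theorem transp_realize (p : ℕ) (A : Matrix (Fin (2 * p)) (Fin (2 * p)) ℂ) :
    transp p (realize p A) = realize p A.transpose := by
  simp only [realize_apply, map_sum, map_smul, transp_mul, transp_witt, transp_wittDag,
    Matrix.transpose_apply]
  exact Finset.sum_comm

theorem transp_idem_smul_vac (p : ℕ) : transp p (idem p) • vac p = vac p := by
  have key : ∀ l : List (Fin (2 * p)), transp p (l.map (vacantProj p)).prod • vac p = vac p := by
    intro l
    induction l with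
    | nil => simp [transp_one]
    | cons j l ih =>
      rw [List.map_cons, List.prod_cons, transp_mul, transp_vacantProj, mul_smul, vacantProj,
        mul_smul, witt_smul_wittDag_smul, witt_smul_vac, smul_zero, sub_zero, ih]
  exact (congrArg (fun a => transp p a • vac p) (idem_eq p)).trans (key _)

/-! ### The highest weight vector -/

/-- The vector `𝔣†_{2r-1} ⋯ 𝔣†_3 𝔣†_1 I`. -/
noncomputable def topVec (p : ℕ) : ℕ → Spinor p
  | 0 => vac p
  | r + 1 => if h : r < p then wittDag p (oddIdx p ⟨r, h⟩) • topVec p r else 0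

theorem topVec_succ {p r : ℕ} (h : r < p) :
    topVec p (r + 1) = wittDag p (oddIdx p ⟨r, h⟩) • topVec p r := by
  rw [topVec, dif_pos h]

theorem topVec_mem_homSpinor {p r : ℕ} (hr : r ≤ p) : topVec p r ∈ homSpinor p r := by
  induction r with
  | zero => rw [homSpinor_zero]; exact Submodule.mem_span_singleton_self _
  | succ r ih => rw [topVec_succ hr]; exact wittDag_smul_mem (ih (by omega)) _

theorem witt_evenIdx_smul_topVec {p r : ℕ} (hr : r ≤ p) (k : Fin p) :
    witt p (evenIdx p k) • topVec p r = 0 := by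
  induction r with
  | zero => exact witt_smul_vac _ _
  | succ r ih =>
    rw [topVec_succ hr, witt_smul_wittDag_smul_of_ne _ (oddIdx_ne_evenIdx p _ _).symm,
      ih (by omega), smul_zero, neg_zero]

theorem witt_oddIdx_smul_topVec {p r : ℕ} (hr : r ≤ p) (k : Fin p) (hk : r ≤ k.val) :
    witt p (oddIdx p k) • topVec p r = 0 := by
  induction r with
  | zero => exact witt_smul_vac _ _
  | succ r ih =>
    rw [topVec_succ hr, witt_smul_wittDag_smul_of_ne, ih (by omega) (by omega), smul_zero, neg_zero]
    rw [Ne, (oddIdx_injective p).eq_iff]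
    rintro rfl
    simp at hk

theorem wittDag_oddIdx_smul_topVec {p r : ℕ} (hr : r ≤ p) (k : Fin p) (hk : k.val < r) :
    wittDag p (oddIdx p k) • topVec p r = 0 := by
  induction r with
  | zero => omega
  | succ r ih =>
    rw [topVec_succ hr]
    rcases Nat.lt_succ_iff_lt_or_eq.mp hk with h | h
    · rw [wittDag_smul_wittDag_smul, ih (by omega) h, smul_zero, neg_zero]
    · have h2 : k = ⟨r, hr⟩ := Fin.ext h
      rw [h2, wittDag_smul_self]

theorem topVec_ne_zero {p r : ℕ} (hr : r ≤ p) : topVec p r ≠ 0 := by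
  induction r with
  | zero => exact vac_ne_zero p
  | succ r ih =>
    intro h
    apply ih (by omega)
    have h2 : witt p (oddIdx p ⟨r, hr⟩) • topVec p (r + 1) = topVec p r := by
      rw [topVec_succ hr, witt_smul_wittDag_smul, witt_oddIdx_smul_topVec (by omega) _ le_rfl,
        smul_zero, sub_zero]
    rw [← h2, h, smul_zero]

theorem topVec_mem_primitivePart {p r : ℕ} (hr : r ≤ p) : topVec p r ∈ primitivePart p r := by
  refine ⟨topVec_mem_homSpinor hr, ?_⟩
  rw [SetLike.mem_coe, LinearMap.mem_ker, opP_apply, clP, Finset.sum_smul]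
  refine Finset.sum_eq_zero fun k _ => ?_
  rw [mul_smul, witt_smul_witt_smul, witt_evenIdx_smul_topVec hr, smul_zero, neg_zero]

/-- The conditions prescribe every occupation number. Annihilating the last occupied label reduces
to `r - 1`, and creating it again recovers `x`, since `𝔣† x = 0` there gives `x = 𝔣† 𝔣 x`. -/
theorem mem_span_topVec {p r : ℕ} (hr : r ≤ p) (x : Spinor p)
    (h1 : ∀ k, witt p (evenIdx p k) • x = 0)
    (h2 : ∀ k : Fin p, r ≤ k.val → witt p (oddIdx p k) • x = 0)
    (h3 : ∀ k : Fin p, k.val < r → wittDag p (oddIdx p k) • x = 0) :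
    ∃ c : ℂ, x = c • topVec p r := by
  induction r generalizing x with
  | zero =>
    have h := mem_span_vac_of_annihilated x fun a => by
      rcases idx_cases p a with ⟨k, rfl⟩ | ⟨k, rfl⟩
      · exact h2 k (Nat.zero_le _)
      · exact h1 k
    obtain ⟨c, hc⟩ := Submodule.mem_span_singleton.mp h
    exact ⟨c, hc.symm⟩
  | succ r ih =>
    obtain ⟨c, hc⟩ := ih (by omega) (witt p (oddIdx p ⟨r, hr⟩) • x)
      (fun k => by rw [witt_smul_witt_smul, h1, smul_zero, neg_zero])
      (fun k hk => by
        rcases Nat.eq_or_lt_of_le hk with h | h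
        · have h2 : k = ⟨r, hr⟩ := Fin.ext h.symm
          rw [h2, witt_smul_self]
        · rw [witt_smul_witt_smul, h2 k h, smul_zero, neg_zero])
      (fun k hk => by
        have hne : oddIdx p ⟨r, hr⟩ ≠ oddIdx p k := by
          rw [Ne, (oddIdx_injective p).eq_iff]
          rintro rfl
          simp at hk
        rw [← neg_eq_zero, ← witt_smul_wittDag_smul_of_ne _ hne, h3 k (by omega), smul_zero])
    refine ⟨c, ?_⟩
    have h4 := witt_smul_wittDag_smul x (oddIdx p ⟨r, hr⟩)
    rw [h3 ⟨r, hr⟩ (Nat.lt_succ_self r), smul_zero, eq_comm, sub_eq_zero, hc, csmul_comm,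
      ← topVec_succ hr] at h4
    exact h4

/-- The transposed product annihilates the labels that `topVec` creates, one after the other; this
makes `topVec` non-isotropic for the form of `exists_contravariant_form`. -/
theorem transp_topVec_smul {p r : ℕ} (hr : r ≤ p) :
    transp p (topVec p r).1 • topVec p r = vac p := by
  induction r with
  | zero => exact transp_idem_smul_vac p
  | succ r ih =>
    have h : (topVec p (r + 1)).1 = wittDag p (oddIdx p ⟨r, hr⟩) * (topVec p r).1 := by
      rw [topVec_succ hr]; rfl
    rw [h, transp_mul, transp_wittDag, topVec_succ hr, mul_smul, witt_smul_wittDag_smul,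
      witt_oddIdx_smul_topVec (by omega) _ le_rfl, smul_zero, sub_zero, ih (by omega)]

/-! ### Sums of commuting idempotents -/

/-- Commuting idempotents have joint eigenvalues `0` and `1`, so `t + ∑ π_i` is injective for `t >
0`. In the induction, applying `π_a` turns `t` into `t + 1` on `π_a z`; hence `π_a z = 0`, and the
term of `a` drops out. -/
theorem eq_zero_of_smul_add_sum_idempotent {ι R M : Type*} [DecidableEq ι] [Ring R]
    [AddCommGroup M] [Module R M] [Module ℂ M] (π : ι → R) (hπ : ∀ i, π i * π i = π i)
    (hc : ∀ i j, Commute (π i) (π j)) (s : Finset ι) :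
    ∀ (t : ℕ), 0 < t → ∀ z : M, t • z + ∑ i ∈ s, π i • z = 0 → z = 0 := by
  induction s using Finset.induction_on with
  | empty =>
    intro t ht z hz
    rw [Finset.sum_empty, add_zero, ← Nat.cast_smul_eq_nsmul ℂ] at hz
    exact (smul_eq_zero.mp hz).resolve_left (Nat.cast_ne_zero.mpr ht.ne')
  | insert a s ha ih =>
    intro t ht z hz
    rw [Finset.sum_insert ha] at hz
    have h1 : (t + 1) • (π a • z) + ∑ i ∈ s, π i • π a • z = 0 := by
      have h := congrArg (π a • ·) hz
      simp only [smul_add, smul_zero, Finset.smul_sum, smul_smul, hπ] at h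
      simp only [smul_smul, (hc _ a).eq]
      rw [← h, smul_comm, add_smul, one_smul, smul_add, add_assoc]
    have h2 := ih (t + 1) (Nat.succ_pos t) _ h1
    rw [h2, zero_add] at hz
    exact ih t ht z hz

theorem smul_eq_zero_of_sum_idempotent {ι R M : Type*} [DecidableEq ι] [Fintype ι] [Ring R]
    [AddCommGroup M] [Module R M] [Module ℂ M] (π : ι → R) (hπ : ∀ i, π i * π i = π i)
    (hc : ∀ i j, Commute (π i) (π j)) (z : M) (h : ∑ i, π i • z = 0) (k : ι) : π k • z = 0 := by
  apply eq_zero_of_smul_add_sum_idempotent π hπ hc (Finset.univ.erase k) 1 one_pos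
  have h2 := congrArg (π k • ·) h
  simp only [smul_zero, Finset.smul_sum, smul_smul] at h2
  rw [← Finset.add_sum_erase _ _ (Finset.mem_univ k), hπ] at h2
  simp only [smul_smul, (hc _ k).eq, one_smul]
  exact h2

/-! ### Uniqueness of the highest weight vector -/

theorem occProj_smul (p : ℕ) (a : Fin (2 * p)) (x : Spinor p) :
    occProj p a • x = wittDag p a • witt p a • x := mul_smul _ _ _

theorem vacantProj_smul (p : ℕ) (a : Fin (2 * p)) (x : Spinor p) :
    vacantProj p a • x = witt p a • wittDag p a • x := mul_smul _ _ _

/-- A primitive vector annihilated by the raising operators is a multiple of `topVec`. -/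
theorem exists_eq_smul_topVec {p r : ℕ} (hr : r ≤ p) {x : Spinor p} (hx : x ∈ primitivePart p r)
    (hlong : ∀ k, wittDag p (oddIdx p k) • witt p (evenIdx p k) • x = 0)
    (hsum : ∀ j k, j ≠ k → wittDag p (oddIdx p j) • witt p (evenIdx p k) • x +
      wittDag p (oddIdx p k) • witt p (evenIdx p j) • x = 0)
    (hdiff : ∀ j k, j < k → wittDag p (oddIdx p j) • witt p (oddIdx p k) • x -
      wittDag p (evenIdx p k) • witt p (evenIdx p j) • x = 0) :
    ∃ c : ℂ, x = c • topVec p r := by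
  set z : Fin p → Spinor p := fun k => witt p (oddIdx p k) • witt p (evenIdx p k) • x with hz
  have hne : ∀ {j k : Fin p}, j ≠ k → oddIdx p j ≠ oddIdx p k := fun h =>
    (oddIdx_injective p).ne h
  -- Apply `𝔣_{2k-1} 𝔣_{2j-1}` to the relation coming from the root `ε_j + ε_k`.
  have hzz : ∀ j k, vacantProj p (oddIdx p j) • z k = vacantProj p (oddIdx p k) • z j := by
    intro j k
    rcases eq_or_ne j k with rfl | hjk
    · rfl
    · have h := congrArg (fun y => witt p (oddIdx p k) • witt p (oddIdx p j) • y) (hsum j k hjk)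
      simp only [smul_add, smul_zero] at h
      rw [← vacantProj_smul, smul_smul (witt p (oddIdx p k)) (vacantProj p _),
        ← (commute_vacantProj_witt p (hne hjk)).eq, ← smul_smul,
        witt_smul_wittDag_smul_of_ne _ (hne hjk), smul_neg, ← vacantProj_smul] at h
      exact add_neg_eq_zero.mp h
  have hzsum : ∑ k, z k = 0 := by
    have h : opP p x = 0 := LinearMap.mem_ker.mp hx.2
    rw [opP_apply, clP, Finset.sum_smul] at h
    rw [← neg_eq_zero, ← h, ← Finset.sum_neg_distrib]
    refine Finset.sum_congr rfl fun k _ => ?_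
    rw [mul_smul, witt_smul_witt_smul]
  -- By `hzz`, `∑_j m_j z_k = m_k ∑_j z_j = 0` for the vacancy idempotents `m_j` of the odd labels.
  -- Each term therefore vanishes, and `m_k z_k = z_k`.
  have hz0 : ∀ k, z k = 0 := by
    intro k
    have h1 : vacantProj p (oddIdx p k) • z k = z k := by
      rw [hz, smul_smul, vacantProj, witt_wittDag_witt]
    rw [← h1]
    refine smul_eq_zero_of_sum_idempotent (fun j => vacantProj p (oddIdx p j))
      (fun j => vacantProj_mul_self p _) (fun i j => commute_vacantProj p _ _) _ ?_ k
    simp only [hzz _ k]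
    rw [← Finset.smul_sum, hzsum, smul_zero]
  -- Split `1 = 𝔣 𝔣† + 𝔣† 𝔣` at the odd partner: `hlong` kills the first half and `hz0` the second.
  have heven : ∀ k, witt p (evenIdx p k) • x = 0 := by
    intro k
    have h := witt_smul_wittDag_smul (witt p (evenIdx p k) • x) (oddIdx p k)
    rw [hlong, smul_zero] at h
    have h2 : witt p (oddIdx p k) • witt p (evenIdx p k) • x = 0 := hz0 k
    rw [h2, smul_zero, sub_zero] at h
    exact h.symm
  set n : Fin p → Cl p := fun k => occProj p (oddIdx p k) with hn
  set m : Fin p → Cl p := fun k => vacantProj p (oddIdx p k) with hm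
  have hnc : ∀ i j, Commute (n i) (n j) := fun i j => commute_occProj p _ _
  have hmc : ∀ i j, Commute (m i) (m j) := fun i j => commute_vacantProj p _ _
  have hn2 : ∀ i, n i * n i = n i := fun i => occProj_mul_self p _
  have hm2 : ∀ i, m i * m i = m i := fun i => vacantProj_mul_self p _
  have hnm : ∀ i, n i = 1 - m i := fun i => occProj_eq p _
  have hdeg : ∑ k, n k • x = r • x := by
    have h := sum_occProj_smul hx.1
    rw [sum_idx, cnat_smul] at h
    rw [← h]
    refine Finset.sum_congr rfl fun k _ => ?_
    rw [occProj_smul p (evenIdx p k), heven, smul_zero, add_zero]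
  -- An odd label can be occupied only if all smaller odd labels are occupied.
  have hord : ∀ j k, j < k → m j • n k • x = 0 := by
    intro j k hjk
    have h := hdiff j k hjk
    rw [heven, smul_zero, sub_zero] at h
    rw [hm, hn]
    simp only
    rw [vacantProj_smul, occProj_smul, wittDag_smul_wittDag_smul, h, smul_zero, neg_zero, smul_zero]
  have hocc : ∀ j k, j < k → n j • n k • x = n k • x := by
    intro j k hjk
    rw [hnm j, sub_smul, one_smul, hord j k hjk, sub_zero]
  -- On `n k • x` the first `k + 1` odd labels (counting from `0`) are occupied, which exceeds the
  -- total `r`; the surplus is positive, so the vector is zero.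
  have hhigh : ∀ k : Fin p, r ≤ k.val → n k • x = 0 := by
    intro k hk
    have h1 : ∑ i, n i • n k • x = r • n k • x := by
      rw [smul_comm r, ← hdeg, Finset.smul_sum]
      refine Finset.sum_congr rfl fun i _ => ?_
      rw [smul_smul, smul_smul, (hnc i k).eq]
    have h2 : ∑ i ∈ Finset.Iic k, n i • n k • x = (k.val + 1) • n k • x := by
      rw [Finset.sum_congr rfl (g := fun _ => n k • x), Finset.sum_const, Fin.card_Iic]
      intro i hi
      rcases (Finset.mem_Iic.mp hi).eq_or_lt with rfl | h
      · rw [smul_smul, hn2]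
      · exact hocc i k h
    rw [← Finset.sum_add_sum_compl (Finset.Iic k), h2] at h1
    obtain ⟨d, hd⟩ := Nat.exists_eq_add_of_le hk
    apply eq_zero_of_smul_add_sum_idempotent n hn2 hnc (Finset.Iic k)ᶜ (d + 1) (Nat.succ_pos d)
    rw [hd, add_assoc, add_smul, add_assoc] at h1
    exact left_eq_add.mp h1.symm
  -- On `m k • x` only odd labels below `k` can be occupied, so the total `r` equals `k - ∑_{i < k}
  -- m_i`, which is impossible for `k < r` unless the vector is zero.
  have hlow : ∀ k : Fin p, k.val < r → m k • x = 0 := by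
    intro k hk
    have hk0 : ∀ i, k ≤ i → n i • m k • x = 0 := by
      intro i hi
      rcases hi.eq_or_lt with rfl | h
      · rw [hnm, sub_smul, one_smul, smul_smul (m k), hm2, sub_self]
      · have hc : Commute (n i) (m k) := by
          rw [hnm]; exact (Commute.one_left _).sub_left (hmc i k)
        rw [smul_smul, hc.eq, ← smul_smul, hord k i h]
    have h1 : ∑ i, n i • m k • x = r • m k • x := by
      rw [smul_comm r, ← hdeg, Finset.smul_sum]
      refine Finset.sum_congr rfl fun i _ => ?_
      have hc : Commute (n i) (m k) := by
        rw [hnm]; exact (Commute.one_left _).sub_left (hmc i k)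
      rw [smul_smul, smul_smul, hc.eq]
    have h2 : ∑ i, n i • m k • x = ∑ i ∈ Finset.Iio k, n i • m k • x := by
      symm
      refine Finset.sum_subset (Finset.subset_univ _) fun i _ hi => hk0 i ?_
      exact not_lt.mp fun h => hi (Finset.mem_Iio.mpr h)
    rw [h2] at h1
    simp only [hnm, sub_smul, one_smul, Finset.sum_sub_distrib, Finset.sum_const, Fin.card_Iio]
      at h1
    obtain ⟨d, hd⟩ := Nat.exists_eq_add_of_lt hk
    apply eq_zero_of_smul_add_sum_idempotent m hm2 hmc (Finset.Iio k) (d + 1) (Nat.succ_pos d)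
    rw [hd, add_assoc, add_smul, sub_eq_iff_eq_add, add_assoc] at h1
    exact left_eq_add.mp h1
  refine mem_span_topVec hr x heven (fun k hk => ?_) (fun k hk => ?_)
  · have h := congrArg (witt p (oddIdx p k) • ·) (hhigh k hk)
    simp only [hn, smul_zero] at h
    rwa [smul_smul, occProj, ← mul_assoc, witt_wittDag_witt] at h
  · have h := congrArg (wittDag p (oddIdx p k) • ·) (hlow k hk)
    simp only [hm, smul_zero] at h
    rwa [smul_smul, vacantProj, ← mul_assoc, wittDag_witt_wittDag] at h

/-! ### Root vectors -/

theorem realize_single (p : ℕ) (j k : Fin (2 * p)) (c : ℂ) :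
    realize p (Matrix.single j k c) = c • (wittDag p j * witt p k) := by
  rw [realize_apply, Finset.sum_eq_single j, Finset.sum_eq_single k] <;>
    simp +contextual [Matrix.single_apply, eq_comm]

/-- The matrix `E_{ab} ∓ E_{b'a'}` of `𝔰𝔭_{2p}(ℂ)`, where `a'` is the partner of `a`. -/
noncomputable def rootMatrix (p : ℕ) (a b : Fin (2 * p)) : Matrix (Fin (2 * p)) (Fin (2 * p)) ℂ :=
  Matrix.single a b 1 - Matrix.single (partner p b) (partner p a) (idxSign p a * idxSign p b)

theorem rootMatrix_mem (p : ℕ) (a b : Fin (2 * p)) : rootMatrix p a b ∈ sp p := by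
  have hp : ∀ i c, partner p i = c ↔ i = partner p c := fun i c =>
    (partner_involutive p).eq_iff
  have h : ∀ i j, idxSign p i * rootMatrix p a b (partner p i) j =
      -(if i = partner p a ∧ j = b then idxSign p a else 0) -
        (if i = b ∧ j = partner p a then idxSign p a else 0) := by
    intro i j
    have h1 : idxSign p i * (if i = partner p a ∧ j = b then (1 : ℂ) else 0) =
        -(if i = partner p a ∧ j = b then idxSign p a else 0) := by
      split_ifs with h
      · rw [h.1, idxSign_partner, mul_one]
      · rw [mul_zero, neg_zero]
    have h2 : idxSign p i * (if i = b ∧ j = partner p a then idxSign p a * idxSign p b else 0) =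
        if i = b ∧ j = partner p a then idxSign p a else 0 := by
      split_ifs with h
      · rw [h.1, mul_left_comm, idxSign_mul_self, mul_one]
      · rw [mul_zero]
    rw [← h1, ← h2, ← mul_sub, rootMatrix, Matrix.sub_apply, Matrix.single_apply,
      Matrix.single_apply]
    simp only [eq_comm (a := a), eq_comm (b := partner p i), eq_comm (a := b), hp, partner_partner]
  rw [mem_sp_iff_apply]
  intro i j
  rw [h, h]
  simp only [and_comm (a := j = partner p a), and_comm (a := j = b)]
  ring

/-- The element of `𝔰𝔭_{2p}(ℂ)` given by `rootMatrix`. -/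
noncomputable def rootElement (p : ℕ) (a b : Fin (2 * p)) : sp p :=
  ⟨rootMatrix p a b, rootMatrix_mem p a b⟩

theorem lie_rootElement (p : ℕ) (a b : Fin (2 * p)) (x : Spinor p) :
    ⁅rootElement p a b, x⁆ = wittDag p a • witt p b • x -
      (idxSign p a * idxSign p b) • wittDag p (partner p b) • witt p (partner p a) • x := by
  change realize p (Matrix.single a b 1 -
    Matrix.single (partner p b) (partner p a) (idxSign p a * idxSign p b)) • x = _
  rw [map_sub, realize_single, realize_single, one_smul,
    sub_smul, smul_assoc, mul_smul, mul_smul]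

/-- The value of the `k`-th diagonal entry functional `ε_k` at the label `a`. -/
noncomputable def diagWeight (p : ℕ) (k : Fin p) (a : Fin (2 * p)) : ℂ :=
  (if a = oddIdx p k then 1 else 0) - (if a = evenIdx p k then 1 else 0)

theorem diagWeight_oddIdx (p : ℕ) (j : Fin p) :
    (fun k => diagWeight p k (oddIdx p j)) = Pi.single j 1 := by
  ext k
  simp [diagWeight, oddIdx_ne_evenIdx, (oddIdx_injective p).eq_iff, Pi.single_apply,
    eq_comm (a := k)]

theorem diagWeight_evenIdx (p : ℕ) (j : Fin p) :
    (fun k => diagWeight p k (evenIdx p j)) = -Pi.single j 1 := by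
  ext k
  simp [diagWeight, (oddIdx_ne_evenIdx p _ _).symm, (evenIdx_injective p).eq_iff, Pi.single_apply,
    eq_comm (a := k)]

theorem diagWeight_partner (p : ℕ) (k : Fin p) (a : Fin (2 * p)) :
    diagWeight p k (partner p a) = -diagWeight p k a := by
  rcases idx_cases p a with ⟨j, rfl⟩ | ⟨j, rfl⟩
  · rw [partner_oddIdx, congrFun (diagWeight_oddIdx p j) k, congrFun (diagWeight_evenIdx p j) k]
    rfl
  · rw [partner_evenIdx, congrFun (diagWeight_oddIdx p j) k, congrFun (diagWeight_evenIdx p j) k]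
    simp

theorem cartanH_eq_diagonal (p : ℕ) (k : Fin p) :
    (cartanH p k).1 = Matrix.diagonal (diagWeight p k) := by
  change Matrix.single _ _ _ - Matrix.single _ _ _ = _
  ext i j
  rw [Matrix.sub_apply, Matrix.single_apply, Matrix.single_apply, Matrix.diagonal_apply, diagWeight]
  rcases eq_or_ne i j with rfl | h
  · simp [eq_comm]
  · rw [if_neg h, if_neg, if_neg, sub_zero]
    · rintro ⟨rfl, h2⟩; exact h h2
    · rintro ⟨rfl, h2⟩; exact h h2

theorem isRootVector_rootElement (p : ℕ) (a b : Fin (2 * p)) :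
    IsRootVector p ((fun k => diagWeight p k a) - fun k => diagWeight p k b)
      (rootElement p a b) := by
  intro k
  apply Subtype.ext
  change ⁅(cartanH p k).1, rootMatrix p a b⁆ = (diagWeight p k a - diagWeight p k b) • rootMatrix p a b
  rw [cartanH_eq_diagonal, Ring.lie_def]
  ext i j
  rw [Matrix.sub_apply, Matrix.diagonal_mul, Matrix.mul_diagonal, Matrix.smul_apply, rootMatrix,
    Matrix.sub_apply, smul_eq_mul]
  have h1 : (diagWeight p k i - diagWeight p k j) * Matrix.single a b (1 : ℂ) i j =
      (diagWeight p k a - diagWeight p k b) * Matrix.single a b (1 : ℂ) i j := by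
    rw [Matrix.single_apply]
    split_ifs with h
    · rw [h.1, h.2]
    · simp
  have h2 : ∀ c, (diagWeight p k i - diagWeight p k j) *
      Matrix.single (partner p b) (partner p a) (c : ℂ) i j =
      (diagWeight p k a - diagWeight p k b) *
        Matrix.single (partner p b) (partner p a) (c : ℂ) i j := by
    intro c
    rw [Matrix.single_apply]
    split_ifs with h
    · rw [← h.1, ← h.2, diagWeight_partner, diagWeight_partner]; ring
    · simp
  linear_combination h1 - h2 (idxSign p a * idxSign p b)

theorem oddOdd_mem_positiveRoots (p : ℕ) {j k : Fin p} (h : j < k) :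
    ((fun i => diagWeight p i (oddIdx p j)) - fun i => diagWeight p i (oddIdx p k)) ∈
      positiveRoots p := by
  rw [diagWeight_oddIdx, diagWeight_oddIdx]
  exact Or.inl ⟨j, k, h, rfl⟩

theorem oddEven_mem_positiveRoots (p : ℕ) (j k : Fin p) :
    ((fun i => diagWeight p i (oddIdx p j)) - fun i => diagWeight p i (evenIdx p k)) ∈
      positiveRoots p := by
  rw [diagWeight_oddIdx, diagWeight_evenIdx, sub_neg_eq_add]
  rcases le_total j k with h | h
  · exact Or.inr ⟨j, k, h, rfl⟩
  · exact Or.inr ⟨k, j, h, add_comm _ _⟩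

/-- A dominant regular element of the Cartan subalgebra. -/
noncomputable def dominantH (p : ℕ) : sp p := ∑ k : Fin p, ((p - k.val : ℕ) : ℂ) • cartanH p k

theorem dominantH_lie {p : ℕ} {α : Fin p → ℂ} {A : sp p} (hA : IsRootVector p α A) :
    ⁅dominantH p, A⁆ = (∑ k : Fin p, ((p - k.val : ℕ) : ℂ) * α k) • A := by
  rw [dominantH, sum_lie, Finset.sum_smul]
  refine Finset.sum_congr rfl fun k _ => ?_
  rw [smul_lie, hA k, smul_smul]

/-- The coefficients `p, p - 1, …, 1` are strictly decreasing, which handles `ε_j - ε_k`, and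
positive, which handles `ε_j + ε_k`. -/
theorem dominantH_pos {p : ℕ} {α : Fin p → ℂ} (hα : α ∈ positiveRoots p) :
    0 < (∑ k : Fin p, ((p - k.val : ℕ) : ℂ) * α k).re := by
  rcases hα with ⟨j, k, hjk, rfl⟩ | ⟨j, k, -, rfl⟩
  · have h : ((p - k.val : ℕ) : ℝ) < ((p - j.val : ℕ) : ℝ) := by
      have h2 : j.val < k.val := hjk
      exact_mod_cast (by omega : p - k.val < p - j.val)
    simpa [mul_sub, Pi.single_apply] using h
  · have h1 : (0 : ℝ) < ((p - j.val : ℕ) : ℝ) := by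
      exact_mod_cast (by omega : 0 < p - j.val)
    have h2 : (0 : ℝ) < ((p - k.val : ℕ) : ℝ) := by
      exact_mod_cast (by omega : 0 < p - k.val)
    simpa [mul_add, Finset.sum_add_distrib, Pi.single_apply] using add_pos h1 h2

/-- A nonzero finite-dimensional module contains a nonzero vector annihilated by all positive root
vectors. -/
theorem exists_annihilated_by_positiveRoots (p : ℕ) (M : Type*) [AddCommGroup M] [Module ℂ M]
    [LieRingModule (sp p) M] [LieModule ℂ (sp p) M] [FiniteDimensional ℂ M] [Nontrivial M] :
    ∃ x : M, x ≠ 0 ∧ ∀ α ∈ positiveRoots p, ∀ A : sp p, IsRootVector p α A → ⁅A, x⁆ = 0 := by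
  set f : Module.End ℂ M := LieModule.toEnd ℂ (sp p) M (dominantH p) with hf
  -- A positive root vector strictly raises the real part of the eigenvalue of `dominantH`, so it
  -- must kill an eigenvector where that real part is maximal.
  obtain ⟨μ, hμ, hmax⟩ := Set.exists_max_image {μ | f.HasEigenvalue μ} Complex.re
    f.finite_hasEigenvalue (Module.End.exists_eigenvalue f)
  obtain ⟨x, hx⟩ := Module.End.HasEigenvalue.exists_hasEigenvector hμ
  refine ⟨x, hx.2, fun α hα A hA => ?_⟩
  by_contra hne
  set c := ∑ k : Fin p, ((p - k.val : ℕ) : ℂ) * α k with hc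
  have hfx : ⁅dominantH p, x⁆ = μ • x := hx.apply_eq_smul
  have h : f ⁅A, x⁆ = (c + μ) • ⁅A, x⁆ := by
    rw [hf, LieModule.toEnd_apply_apply, leibniz_lie, dominantH_lie hA, hfx, smul_lie, lie_smul,
      add_smul]
  have h2 := hmax (c + μ) (Module.End.hasEigenvalue_of_hasEigenvector
    (x := ⁅A, x⁆) ⟨Module.End.mem_eigenspace_iff.mpr h, hne⟩)
  have h3 := dominantH_pos hα
  rw [Complex.add_re] at h2
  linarith

/-! ### Irreducibility of the primitive parts -/

/-- The primitive part `𝕊^r_r` as a Lie submodule. -/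
noncomputable def primitiveLie (p r : ℕ) : LieSubmodule ℂ (sp p) (Spinor p) where
  __ := primitivePart p r
  lie_mem {A x} hx := by
    refine ⟨lie_mem_homSpinor A hx.1, ?_⟩
    have h : opP p x = 0 := LinearMap.mem_ker.mp hx.2
    rw [SetLike.mem_coe, LinearMap.mem_ker, opP_lie, h, lie_zero]

theorem mem_primitiveLie {p r : ℕ} {x : Spinor p} :
    x ∈ primitiveLie p r ↔ x ∈ primitivePart p r := Iff.rfl

instance finiteDimensional_primitivePart (p r : ℕ) : FiniteDimensional ℂ (primitivePart p r) :=
  Submodule.finiteDimensional_of_le (inf_le_left : primitivePart p r ≤ homSpinor p r)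

theorem exists_eq_smul_topVec_of_positiveRoots {p r : ℕ} (hr : r ≤ p) {x : Spinor p}
    (hx : x ∈ primitivePart p r)
    (h : ∀ α ∈ positiveRoots p, ∀ A : sp p, IsRootVector p α A → ⁅A, x⁆ = 0) :
    ∃ c : ℂ, x = c • topVec p r := by
  have hoe : ∀ j k, wittDag p (oddIdx p j) • witt p (evenIdx p k) • x +
      wittDag p (oddIdx p k) • witt p (evenIdx p j) • x = 0 := by
    intro j k
    have h1 := h _ (oddEven_mem_positiveRoots p j k) _ (isRootVector_rootElement p _ _)
    rw [lie_rootElement, partner_oddIdx, partner_evenIdx, idxSign_oddIdx, idxSign_evenIdx, one_mul,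
      cneg_one_smul, sub_neg_eq_add] at h1
    exact h1
  refine exists_eq_smul_topVec hr hx (fun k => ?_) (fun j k _ => hoe j k) (fun j k hjk => ?_)
  -- For `j = k` the two terms coincide, so the long root relation appears doubled.
  · have h1 := hoe k k
    exact eq_zero_of_eq_neg_self (eq_neg_of_add_eq_zero_left h1)
  · have h1 := h _ (oddOdd_mem_positiveRoots p hjk) _ (isRootVector_rootElement p _ _)
    rwa [lie_rootElement, partner_oddIdx, partner_oddIdx, idxSign_oddIdx, idxSign_oddIdx, one_mul,
      cone_smul] at h1

/-- The second conclusion is a by-product: the vector found in `N` is a nonzero multiple of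
`topVec`, so `topVec` inherits annihilation by the positive root vectors without a direct
computation. -/
theorem exists_smul_topVec_mem {p r : ℕ} (hr : r ≤ p) (N : LieSubmodule ℂ (sp p) (Spinor p))
    (hN : N ≤ primitiveLie p r) (hN0 : N ≠ ⊥) :
    topVec p r ∈ N ∧
      ∀ α ∈ positiveRoots p, ∀ A : sp p, IsRootVector p α A → ⁅A, topVec p r⁆ = 0 := by
  have hfin : FiniteDimensional ℂ N :=
    Submodule.finiteDimensional_of_le (S₂ := primitivePart p r) hN
  have hnt : Nontrivial N := (LieSubmodule.nontrivial_iff_ne_bot ..).mpr hN0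
  obtain ⟨⟨x, hxN⟩, hx0, hx⟩ := exists_annihilated_by_positiveRoots p N
  have hx' : ∀ α ∈ positiveRoots p, ∀ A : sp p, IsRootVector p α A → ⁅A, x⁆ = 0 :=
    fun α hα A hA => congrArg Subtype.val (hx α hα A hA)
  obtain ⟨c, rfl⟩ := exists_eq_smul_topVec_of_positiveRoots hr (hN hxN) hx'
  have hc : c ≠ 0 := by
    rintro rfl
    exact hx0 (Subtype.ext (czero_smul _))
  have ht : topVec p r = c⁻¹ • c • topVec p r := by
    rw [← cmul_smul, inv_mul_cancel₀ hc, cone_smul]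
  refine ⟨?_, fun α hα A hA => ?_⟩
  · rw [ht]; exact N.smul_mem _ hxN
  · rw [ht, lie_smul c⁻¹ A (c • topVec p r), hx' α hα A hA, csmul_zero]

theorem primitiveLie_ne_bot {p r : ℕ} (hr : r ≤ p) : primitiveLie p r ≠ ⊥ := by
  intro h
  have h2 : topVec p r ∈ primitiveLie p r := topVec_mem_primitivePart hr
  rw [h, LieSubmodule.mem_bot] at h2
  exact topVec_ne_zero hr h2

/-- The form is `B x y = φ (xᵗ y)`, where `t` is `transp` and `φ` is any functional with `φ I ≠ 0`.
Adjointness holds because `transp` reverses products and sends the realization of `A` to that of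
`Aᵀ`. -/
theorem exists_contravariant_form (p : ℕ) :
    ∃ B : Spinor p →ₗ[ℂ] Spinor p →ₗ[ℂ] ℂ,
      (∀ (A : sp p) x y, B ⁅A, x⁆ y = B x ⁅(⟨A.1.transpose, transpose_mem_sp A.2⟩ : sp p), y⁆) ∧
      ∀ r ≤ p, B (topVec p r) (topVec p r) ≠ 0 := by
  obtain ⟨φ, hφ⟩ := Module.exists_dual_forall_apply_ne_zero (K := ℂ) (fun _ : Unit => vac p)
    (fun _ => vac_ne_zero p)
  refine ⟨LinearMap.mk₂ ℂ (fun x y => φ (transp p x.1 • y)) ?_ ?_ ?_ ?_, ?_, ?_⟩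
  · intro x y z
    change φ (transp p (x.1 + y.1) • z) = _
    rw [map_add, add_smul, map_add]
  · intro c x y
    change φ (transp p (c • x.1) • y) = c • φ (transp p x.1 • y)
    rw [(transp p).map_smul, smul_assoc, φ.map_smul]
  · intro x y z
    rw [smul_add, map_add]
  · intro c x y
    rw [csmul_comm, φ.map_smul]
  · intro A x y
    change φ (transp p (realize p A.1 * x.1) • y) = φ (transp p x.1 • realize p A.1.transpose • y)
    rw [transp_mul, transp_realize, mul_smul]
  · intro r hr
    rw [LinearMap.mk₂_apply, transp_topVec_smul hr]
    exact hφ ()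

theorem eq_primitiveLie_of_le {p r : ℕ} (hr : r ≤ p) (N : LieSubmodule ℂ (sp p) (Spinor p))
    (hN : N ≤ primitiveLie p r) (hN0 : N ≠ ⊥) : N = primitiveLie p r := by
  obtain ⟨B, hB, hB0⟩ := exists_contravariant_form p
  -- The orthogonal complement of `N` in `𝕊^r_r`; it is a submodule because `𝔰𝔭_{2p}` is closed
  -- under transposition.
  let N' : LieSubmodule ℂ (sp p) (Spinor p) :=
    { carrier := {x | x ∈ primitiveLie p r ∧ ∀ n ∈ N, B x n = 0}
      add_mem' := fun {x y} hx hy => ⟨add_mem hx.1 hy.1, fun n hn => by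
        rw [map_add, LinearMap.add_apply, hx.2 n hn, hy.2 n hn, add_zero]⟩
      zero_mem' := ⟨zero_mem _, fun n _ => by rw [map_zero, LinearMap.zero_apply]⟩
      smul_mem' := fun c x hx => ⟨(primitiveLie p r).smul_mem c hx.1, fun n hn => by
        rw [map_smul, LinearMap.smul_apply, hx.2 n hn, smul_zero]⟩
      lie_mem := fun {A x} hx => ⟨(primitiveLie p r).lie_mem hx.1, fun n hn => by
        rw [hB]; exact hx.2 _ (N.lie_mem hn)⟩ }
  have hN' : N' = ⊥ := by
    by_contra h
    have h1 := (exists_smul_topVec_mem hr N' (fun x hx => hx.1) h).1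
    exact hB0 r hr (h1.2 _ (exists_smul_topVec_mem hr N hN hN0).1)
  have hfin : FiniteDimensional ℂ N.toSubmodule :=
    Submodule.finiteDimensional_of_le (S₂ := primitivePart p r) hN
  -- The kernel of `x ↦ B x` restricted to `N` is `N' = 0`, so `𝕊^r_r` embeds into the dual of `N`
  -- and `dim 𝕊^r_r ≤ dim N`.
  have hinj : Function.Injective (B.domRestrict₁₂ (primitivePart p r) N.toSubmodule) := by
    rw [← LinearMap.ker_eq_bot, LinearMap.ker_eq_bot']
    rintro ⟨x, hx⟩ h
    have hxN : x ∈ N' := ⟨hx, fun n hn => congrArg (fun g => g ⟨n, hn⟩) h⟩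
    rw [hN', LieSubmodule.mem_bot] at hxN
    exact Subtype.ext hxN
  have hrank := LinearMap.finrank_le_finrank_of_injective hinj
  have hdual : Module.finrank ℂ (N.toSubmodule →ₗ[ℂ] ℂ) = Module.finrank ℂ N.toSubmodule :=
    Subspace.dual_finrank_eq
  rw [hdual] at hrank
  exact LieSubmodule.toSubmodule_injective
    (Submodule.eq_of_le_of_finrank_le (S₂ := primitivePart p r) hN hrank)

theorem isIrreducible_of_forall_le {L V : Type*} [LieRing L] [LieAlgebra ℂ L] [AddCommGroup V]
    [Module ℂ V] [LieRingModule L V] [LieModule ℂ L V] (M : LieSubmodule ℂ L V) (hM : M ≠ ⊥)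
    (h : ∀ N ≤ M, N ≠ ⊥ → N = M) : LieModule.IsIrreducible ℂ L M := by
  have hnt : Nontrivial M := (LieSubmodule.nontrivial_iff_ne_bot ..).mpr hM
  refine LieModule.IsIrreducible.mk fun N hN => ?_
  have h1 : LieSubmodule.map M.incl N ≠ ⊥ := by
    intro h0
    apply hN
    rw [LieSubmodule.eq_bot_iff] at h0 ⊢
    intro x hx
    exact Subtype.ext (h0 x.1 (LieSubmodule.mem_map_of_mem hx))
  have h2 := h _ LieSubmodule.map_incl_le h1
  rw [eq_top_iff]
  rintro ⟨x, hx⟩ -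
  have h3 : x ∈ LieSubmodule.map M.incl N := by rw [h2]; exact hx
  obtain ⟨y, hy, rfl⟩ := (LieSubmodule.mem_map x).mp h3
  exact hy

theorem isIrreducible_primitiveLie {p r : ℕ} (hr : r ≤ p) :
    LieModule.IsIrreducible ℂ (sp p) (primitiveLie p r) :=
  isIrreducible_of_forall_le _ (primitiveLie_ne_bot hr) (eq_primitiveLie_of_le hr)

theorem cartanH_lie_topVec {p r : ℕ} (hr : r ≤ p) (k : Fin p) :
    ⁅cartanH p k, topVec p r⁆ = oneWeight p r k • topVec p r := by
  have h : (cartanH p k).1 = Matrix.single (oddIdx p k) (oddIdx p k) 1 -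
    Matrix.single (evenIdx p k) (evenIdx p k) 1 := rfl
  rw [lie_spinor, h, map_sub, realize_single, realize_single, one_smul, one_smul, sub_smul,
    mul_smul, mul_smul, witt_evenIdx_smul_topVec hr, smul_zero, sub_zero, oneWeight]
  split_ifs with hk
  · have h1 := witt_smul_wittDag_smul (topVec p r) (oddIdx p k)
    rw [wittDag_oddIdx_smul_topVec hr k hk, smul_zero] at h1
    rw [cone_smul]
    exact (sub_eq_zero.mp h1.symm).symm
  · rw [witt_oddIdx_smul_topVec hr k (not_lt.mp hk), smul_zero, czero_smul]

theorem isIrreducibleOfHighestWeight_primitiveLie {p r : ℕ} (hr : r ≤ p) :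
    IsIrreducibleOfHighestWeight p (oneWeight p r) (primitiveLie p r) := by
  refine ⟨isIrreducible_primitiveLie hr, ⟨topVec p r, topVec_mem_primitivePart hr⟩, ?_, ?_, ?_⟩
  · exact fun h => topVec_ne_zero hr (congrArg Subtype.val h)
  · exact fun k => Subtype.ext (cartanH_lie_topVec hr k)
  · intro α hα A hA
    exact Subtype.ext
      ((exists_smul_topVec_mem hr _ le_rfl (primitiveLie_ne_bot hr)).2 α hα A hA)

/-! ### The cells -/

/-- The operator `Q^k` as a morphism of modules. -/
noncomputable def opQPow (p k : ℕ) : Spinor p →ₗ⁅ℂ, sp p⁆ Spinor p where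
  __ := opQ p ^ k
  map_lie' {A x} := opQ_pow_lie p k A x

/-- `Q^k` is equivariant, and it is nonzero on `topVec` since `P^k Q^k` is a nonzero scalar there. A
nonzero submodule of the image pulls back to a nonzero submodule of the irreducible primitive part,
hence to all of it. -/
theorem isIrreducible_map_opQPow {p s : ℕ} (k : ℕ) (h : s + k ≤ p) :
    LieModule.IsIrreducible ℂ (sp p) (LieSubmodule.map (opQPow p k) (primitiveLie p s)) := by
  have hs : s ≤ p := by omega
  refine isIrreducible_of_forall_le _ ?_ fun N hN hN0 => le_antisymm hN ?_
  · intro h0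
    rw [LieSubmodule.eq_bot_iff] at h0
    have ht := topVec_mem_primitivePart hs
    have h1 : (opQ p ^ k) (topVec p s) = 0 :=
      h0 _ (LieSubmodule.mem_map_of_mem (f := opQPow p k) (mem_primitiveLie.mpr ht))
    obtain ⟨c, hc, h2⟩ := exists_opP_pow_opQ_pow ht k h
    rw [h1, map_zero] at h2
    apply topVec_ne_zero hs
    rw [← cone_smul (topVec p s), ← inv_mul_cancel₀ hc, cmul_smul, ← h2, csmul_zero]
  · have h1 : LieSubmodule.comap (opQPow p k) N ⊓ primitiveLie p s = primitiveLie p s := by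
      refine eq_primitiveLie_of_le hs _ inf_le_right fun h0 => hN0 ?_
      rw [LieSubmodule.eq_bot_iff] at h0 ⊢
      intro x hx
      obtain ⟨y, hy, rfl⟩ := (LieSubmodule.mem_map x).mp (hN hx)
      rw [h0 y ⟨hx, hy⟩, map_zero]
    rw [LieSubmodule.map_le_iff_le_comap]
    exact inf_eq_right.mp h1

end SymplecticCells

theorem mainTheorem1 (p r : ℕ) (hr : r ≤ p) :
    (∃ N : LieSubmodule ℂ (sp p) (Spinor p),
      N.toSubmodule = primitivePart p r ∧
        IsIrreducibleOfHighestWeight p (oneWeight p r) N) ∧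
    (⨆ j : Fin (r / 2 + 1), cell p (r - 2 * j.val) j.val) = homSpinor p r ∧
    iSupIndep (fun j : Fin (r / 2 + 1) => cell p (r - 2 * j.val) j.val) ∧
    ∀ j : Fin (r / 2 + 1), ∃ N : LieSubmodule ℂ (sp p) (Spinor p),
      N.toSubmodule = cell p (r - 2 * j.val) j.val ∧
        LieModule.IsIrreducible ℂ (sp p) N :=
  ⟨⟨primitiveLie p r, rfl, isIrreducibleOfHighestWeight_primitiveLie hr⟩, iSup_cell hr,
    iSupIndep_cell hr, fun j => ⟨LieSubmodule.map (opQPow p j.val) (primitiveLie p (r - 2 * j.val)),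
      rfl, isIrreducible_map_opQPow j.val (by omega)⟩⟩
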